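/- Let $m,n\ge 0$ be integers. For a real $m\times n$ matrix $A$ and an integer $0\le k\le\min(m,n)$, a $k$-assignment is a set of $k$ matrix positions, no two of which belong to the same row or column; its cost is the sum of the entries of $A$ in these positions, and $\min_k(A)$ denotes the minimum cost of all $k$-assignments in $A$. (Coppersmith–Sorkin formula) Let $M$ be a random $m\times n$ matrix whose entries are independent exponential random variables of rate $1$, that is, $\Pr(M(i,j)>t)=e^{-t}$ for all $t\ge 0$. Then for every integer $0\le k\le\min(m,n)$ the random variable $\min_k(M)$ is integrable and $$\mathbb{E}[\min\nolimits_k(M)]=\sum_{\substack{i,j\ge 0\\ i+j<k}}\frac{1}{(m-i)(n-j)}.$$ (Parisi formula) In particular, if $m=n$, then $$\mathbb{E}[\min\nolimits_n(M)]=\sum_{i=1}^{n}\frac{1}{i^2}.$$ -/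

import Mathlib

open MeasureTheory ProbabilityTheory

noncomputable section

namespace RandomAssignment

/-- A `k`-assignment: a set of `k` sites, no two of which belong to the same row or column. -/
def IsAssignment {R C : Type*} (k : ℕ) (π : Finset (R × C)) : Prop :=
  π.card = k ∧ ∀ p ∈ π, ∀ q ∈ π, p ≠ q → p.1 ≠ q.1 ∧ p.2 ≠ q.2

/-- The cost of a set of sites: the sum of the matrix entries in it. -/
def cost {R C : Type*} (A : Matrix R C ℝ) (π : Finset (R × C)) : ℝ :=
  ∑ p ∈ π, A p.1 p.2

/-- The minimum cost of all `k`-assignments in `A`. It is an attained minimum as soon as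
`k`-assignments exist, see `isLeast_minCost`. -/
def minCost {R C : Type*} (k : ℕ) (A : Matrix R C ℝ) : ℝ :=
  sInf {c : ℝ | ∃ π : Finset (R × C), IsAssignment k π ∧ c = cost A π}

theorem exists_isAssignment {m n k : ℕ} (hk : k ≤ min m n) :
    ∃ π : Finset (Fin m × Fin n), IsAssignment k π := by
  have hm : k ≤ m := le_trans hk (min_le_left _ _)
  have hn : k ≤ n := le_trans hk (min_le_right _ _)
  refine ⟨(Finset.univ : Finset (Fin k)).map
    ⟨fun i => (Fin.castLE hm i, Fin.castLE hn i), fun i j h => ?_⟩, ?_, ?_⟩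
  · simpa using congrArg Prod.fst h
  · simp
  · intro p hp q hq hpq
    simp only [Finset.mem_map, Finset.mem_univ, true_and] at hp hq
    obtain ⟨i, rfl⟩ := hp
    obtain ⟨j, rfl⟩ := hq
    have hij : i ≠ j := fun h => hpq (by rw [h])
    exact ⟨fun h => hij (Fin.castLE_injective hm h), fun h => hij (Fin.castLE_injective hn h)⟩

theorem isLeast_minCost {m n k : ℕ} (hk : k ≤ min m n) (A : Matrix (Fin m) (Fin n) ℝ) :
    IsLeast {c : ℝ | ∃ π : Finset (Fin m × Fin n), IsAssignment k π ∧ c = cost A π}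
      (minCost k A) := by
  have hfin : {c : ℝ | ∃ π : Finset (Fin m × Fin n),
      IsAssignment k π ∧ c = cost A π}.Finite := by
    refine (Set.finite_range (cost A)).subset ?_
    rintro c ⟨π, -, rfl⟩
    exact ⟨π, rfl⟩
  obtain ⟨π, hπ⟩ := exists_isAssignment hk
  have hne : {c : ℝ | ∃ π : Finset (Fin m × Fin n),
      IsAssignment k π ∧ c = cost A π}.Nonempty := ⟨_, π, hπ, rfl⟩
  exact ⟨hne.csInf_mem hfin, fun c hc => csInf_le hfin.bddBelow hc⟩

/-- The entries of the random matrix `M` are independent, and each of them is exponentially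
distributed with rate `1`. -/
structure IsRateOneMatrix {Ω : Type*} [MeasurableSpace Ω] (P : Measure Ω) {m n : ℕ}
    (M : Ω → Matrix (Fin m) (Fin n) ℝ) : Prop where
  hasLaw : ∀ i j, HasLaw (fun ω => M ω i j) (expMeasure 1) P
  indep : iIndepFun (fun (p : Fin m × Fin n) (ω : Ω) => M ω p.1 p.2) P

end RandomAssignment

end

noncomputable section

namespace RandomAssignment

/-! ### Exchanges along alternating paths -/

section Exchange

variable {R C : Type*}

/-! Columns are deleted one at a time. For an `m × n` matrix, `colGain j k` compares the minimum for
`k + 1` with the minimum for `k` after column `j` is removed. The smaller matrix again has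
independent rate-one entries, so by induction it suffices to know that the expected gains, summed
over `j`, equal the sum of `1 / (m - i)` over `i ≤ k`. This telescopes to `sum_integral_gain`: `m -
k` times the expected sum over `j` of `colGain j k - prevGain j k` is `1`.

The core is an identity for a single site, `lintegral_gain_eq_measure`. Almost surely optima are
unique. Fix all entries except `t = x (a, j)`. If the optimal `k`-assignment avoids row `a`, the
difference of gains is `max 0 (min t w - v)`, with `v` and `w` independent of `t` (possibly `w =
∞`). Up to a null set the avoidance is the condition `v < t` together with a condition on the other
entries, and `(a, j)` lies in the optimal `k + 1`-assignment iff `t ≤ w`. For exponential `t` the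
mean of this difference is the probability of `v < t ≤ w`, because the density equals the tail. Now
sum over all sites. On one side each column is counted once for each of the `m - k` unused rows; on
the other side stands `1`, because used rows remain in use (`IsGeneric.usesRow_mono`) and so exactly
one site of the new optimum lies in a new row.

The formula for the difference of gains, `AvoidsRow.colGain_sub_prevGain`, rests on exchanging two
assignments along alternating paths (`exists_exchange`, `exists_augment`,
`exists_augment_avoiding`). -/

theorem IsAssignment.eq_of_fst {k : ℕ} {π : Finset (R × C)} (h : IsAssignment k π)
    {p q : R × C} (hp : p ∈ π) (hq : q ∈ π) (hpq : p.1 = q.1) : p = q := by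
  by_contra hne
  exact (h.2 p hp q hq hne).1 hpq

theorem IsAssignment.eq_of_snd {k : ℕ} {π : Finset (R × C)} (h : IsAssignment k π)
    {p q : R × C} (hp : p ∈ π) (hq : q ∈ π) (hpq : p.2 = q.2) : p = q := by
  by_contra hne
  exact (h.2 p hp q hq hne).2 hpq

theorem IsAssignment.subset {k : ℕ} {π ρ : Finset (R × C)} (h : IsAssignment k π) (hρ : ρ ⊆ π) :
    IsAssignment ρ.card ρ :=
  ⟨rfl, fun p hp q hq => h.2 p (hρ hp) q (hρ hq)⟩

/-- The row `i` contains a site of `π`. -/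
def UsesRow (π : Finset (R × C)) (i : R) : Prop := ∃ p ∈ π, p.1 = i

/-- The column `j` contains a site of `π`. -/
def UsesCol (π : Finset (R × C)) (j : C) : Prop := ∃ p ∈ π, p.2 = j

open scoped Classical in
/-- The sites of `σ` in rows outside `U` together with the sites of `τ` in rows inside `U`. -/
def swapRows (U : Finset R) (σ τ : Finset (R × C)) : Finset (R × C) :=
  σ.filter (fun p => p.1 ∉ U) ∪ τ.filter (fun p => p.1 ∈ U)

theorem mem_swapRows {U : Finset R} {σ τ : Finset (R × C)} {p : R × C} :
    p ∈ swapRows U σ τ ↔ (p ∈ σ ∧ p.1 ∉ U) ∨ (p ∈ τ ∧ p.1 ∈ U) := by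
  simp [swapRows]

open scoped Classical in
theorem sum_swapRows {M : Type*} [AddCommMonoid M] (U : Finset R) (σ τ : Finset (R × C))
    (x : R × C → M) :
    ∑ p ∈ swapRows U σ τ, x p =
      ∑ p ∈ σ.filter (fun p => p.1 ∉ U), x p + ∑ p ∈ τ.filter (fun p => p.1 ∈ U), x p := by
  refine Finset.sum_union ?_
  rw [Finset.disjoint_left]
  intro p hp hq
  exact (Finset.mem_filter.1 hp).2 (Finset.mem_filter.1 hq).2

theorem sum_swapRows_add {M : Type*} [AddCommMonoid M] (U : Finset R) (σ τ : Finset (R × C))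
    (x : R × C → M) :
    ∑ p ∈ swapRows U σ τ, x p + ∑ p ∈ swapRows U τ σ, x p = ∑ p ∈ σ, x p + ∑ p ∈ τ, x p := by
  classical
  rw [sum_swapRows, sum_swapRows, ← Finset.sum_filter_add_sum_filter_not σ (fun p => p.1 ∈ U),
    ← Finset.sum_filter_add_sum_filter_not τ (fun p => p.1 ∈ U)]
  abel

open scoped Classical in
theorem card_swapRows (U : Finset R) (σ τ : Finset (R × C)) :
    (swapRows U σ τ).card =
      (σ.filter (fun p => p.1 ∉ U)).card + (τ.filter (fun p => p.1 ∈ U)).card := by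
  simpa only [Finset.card_eq_sum_ones] using sum_swapRows U σ τ (fun _ => 1)

/-- The step of an alternating path: from a row along `τ` to a column, then along `σ` to a row. -/
def AltStep (σ τ : Finset (R × C)) (s s' : R) : Prop := ∃ c, (s, c) ∈ τ ∧ (s', c) ∈ σ

variable [Fintype R]

open scoped Classical in
/-- The rows on the alternating path that leaves the row `t` along `τ`. -/
def altRows (σ τ : Finset (R × C)) (t : R) : Finset R :=
  Finset.univ.filter (Relation.ReflTransGen (AltStep σ τ) t)

variable {σ τ : Finset (R × C)} {s t : R} {k l : ℕ}

theorem mem_altRows : s ∈ altRows σ τ t ↔ Relation.ReflTransGen (AltStep σ τ) t s := by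
  simp [altRows]

theorem self_mem_altRows : t ∈ altRows σ τ t := mem_altRows.2 .refl

theorem altRows_forward {s' : R} {c : C} (hs : s ∈ altRows σ τ t) (h : (s, c) ∈ τ)
    (h' : (s', c) ∈ σ) : s' ∈ altRows σ τ t :=
  mem_altRows.2 ((mem_altRows.1 hs).tail ⟨c, h, h'⟩)

theorem usesRow_of_mem_altRows (hs : s ∈ altRows σ τ t) (hst : s ≠ t) : UsesRow σ s := by
  rcases (mem_altRows.1 hs).cases_tail with h | ⟨u, -, c, -, h⟩
  · exact absurd h hst
  · exact ⟨_, h, rfl⟩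

/-- The path enters rows along `σ`, and `σ` has only one site per row. So a `σ`-site in a reached
row is the one by which the path came in, and its column was left from an earlier row. -/
theorem altRows_backward {c : C} (hσ : IsAssignment k σ) (ht : ¬ UsesRow σ t)
    (hs : s ∈ altRows σ τ t) (h : (s, c) ∈ σ) : ∃ u ∈ altRows σ τ t, (u, c) ∈ τ := by
  rcases (mem_altRows.1 hs).cases_tail with rfl | ⟨u, hu, d, hd, hd'⟩
  · exact absurd ⟨_, h, rfl⟩ ht
  · obtain rfl : d = c := congrArg Prod.snd (hσ.eq_of_fst hd' h rfl)
    exact ⟨u, mem_altRows.2 hu, hd⟩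

/-- Steps are uniquely reversible, so tracing back from a common row leads to one and the same
start; a start is never entered, being unused by `σ`. -/
theorem altRows_disjoint {t' : R} (hσ : IsAssignment k σ) (hτ : IsAssignment l τ)
    (ht : ¬ UsesRow σ t) (ht' : ¬ UsesRow σ t') (hs : s ∈ altRows σ τ t)
    (hs' : s ∈ altRows σ τ t') : t = t' := by
  rw [mem_altRows] at hs hs'
  induction hs with
  | refl =>
    by_contra hne
    exact ht (usesRow_of_mem_altRows (mem_altRows.2 hs') hne)
  | @tail u s _ hus ih =>
    obtain ⟨c, hu, hs⟩ := hus
    rcases hs'.cases_tail with rfl | ⟨w, hw, d, hwd, hsd⟩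
    · exact absurd ⟨_, hs, rfl⟩ ht'
    · obtain rfl : d = c := congrArg Prod.snd (hσ.eq_of_fst hsd hs rfl)
      obtain rfl : w = u := congrArg Prod.fst (hτ.eq_of_snd hwd hu rfl)
      exact ih hw

/-- Only column conflicts between a `σ`-site outside and a `τ`-site inside are in question; forward
closure of the path excludes them. The opposite swap below needs backward closure, hence a start
unused by `σ`. -/
theorem isAssignment_swapRows_altRows (hσ : IsAssignment k σ) (hτ : IsAssignment l τ) :
    IsAssignment (swapRows (altRows σ τ t) σ τ).card (swapRows (altRows σ τ t) σ τ) := by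
  refine ⟨rfl, ?_⟩
  have key : ∀ p q : R × C, p ∈ σ → p.1 ∉ altRows σ τ t → q ∈ τ → q.1 ∈ altRows σ τ t →
      p.1 ≠ q.1 ∧ p.2 ≠ q.2 := by
    rintro ⟨i, c⟩ ⟨i', d⟩ hp hpU hq hqU
    refine ⟨fun h => hpU (h ▸ hqU), fun h => ?_⟩
    obtain rfl : c = d := h
    exact hpU (altRows_forward hqU hq hp)
  intro p hp q hq hpq
  rcases mem_swapRows.1 hp with ⟨hp, hpU⟩ | ⟨hp, hpU⟩ <;>
    rcases mem_swapRows.1 hq with ⟨hq, hqU⟩ | ⟨hq, hqU⟩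
  · exact hσ.2 p hp q hq hpq
  · exact key p q hp hpU hq hqU
  · exact ⟨(key q p hq hqU hp hpU).1.symm, (key q p hq hqU hp hpU).2.symm⟩
  · exact hτ.2 p hp q hq hpq

theorem isAssignment_swapRows_altRows' (hσ : IsAssignment k σ) (hτ : IsAssignment l τ)
    (ht : ¬ UsesRow σ t) :
    IsAssignment (swapRows (altRows σ τ t) τ σ).card (swapRows (altRows σ τ t) τ σ) := by
  refine ⟨rfl, ?_⟩
  have key : ∀ p q : R × C, p ∈ τ → p.1 ∉ altRows σ τ t → q ∈ σ → q.1 ∈ altRows σ τ t →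
      p.1 ≠ q.1 ∧ p.2 ≠ q.2 := by
    rintro ⟨i, c⟩ ⟨i', d⟩ hp hpU hq hqU
    refine ⟨fun h => hpU (h ▸ hqU), fun h => ?_⟩
    obtain rfl : c = d := h
    obtain ⟨u, hu, huc⟩ := altRows_backward hσ ht hqU hq
    obtain rfl : u = i := congrArg Prod.fst (hτ.eq_of_snd huc hp rfl)
    exact hpU hu
  intro p hp q hq hpq
  rcases mem_swapRows.1 hp with ⟨hp, hpU⟩ | ⟨hp, hpU⟩ <;>
    rcases mem_swapRows.1 hq with ⟨hq, hqU⟩ | ⟨hq, hqU⟩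
  · exact hτ.2 p hp q hq hpq
  · exact key p q hp hpU hq hqU
  · exact ⟨(key q p hq hqU hp hpU).1.symm, (key q p hq hqU hp hpU).2.symm⟩
  · exact hσ.2 p hp q hq hpq

theorem usesCol_of_swapRows_altRows {j : C} (hσ : IsAssignment k σ) (ht : ¬ UsesRow σ t)
    (hj : UsesCol (swapRows (altRows σ τ t) τ σ) j) : UsesCol τ j := by
  obtain ⟨⟨i, c⟩, hp, rfl⟩ := hj
  rcases mem_swapRows.1 hp with ⟨hp, hpU⟩ | ⟨hp, hpU⟩
  · exact ⟨_, hp, rfl⟩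
  · obtain ⟨u, -, hu⟩ := altRows_backward hσ ht hpU hp
    exact ⟨_, hu, rfl⟩

open scoped Classical in
theorem card_altRows_filter_le (hσ : IsAssignment k σ) (ht : ¬ UsesRow σ t) :
    (σ.filter (fun p => p.1 ∈ altRows σ τ t)).card ≤
      (τ.filter (fun p => p.1 ∈ altRows σ τ t)).card := by
  have h1 : (σ.filter (fun p => p.1 ∈ altRows σ τ t)).card =
      ((σ.filter (fun p => p.1 ∈ altRows σ τ t)).image Prod.snd).card := by
    refine (Finset.card_image_of_injOn ?_).symm
    intro p hp q hq h
    exact hσ.eq_of_snd (Finset.mem_filter.1 hp).1 (Finset.mem_filter.1 hq).1 h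
  rw [h1]
  refine le_trans (Finset.card_le_card ?_)
    (Finset.card_image_le (s := τ.filter (fun p => p.1 ∈ altRows σ τ t)) (f := Prod.snd))
  intro c hc
  obtain ⟨⟨i, c⟩, hp, rfl⟩ := Finset.mem_image.1 hc
  obtain ⟨hp, hpU⟩ := Finset.mem_filter.1 hp
  obtain ⟨u, hu, huc⟩ := altRows_backward hσ ht hpU hp
  exact Finset.mem_image.2 ⟨(u, c), Finset.mem_filter.2 ⟨huc, hu⟩, rfl⟩

open scoped Classical in
theorem card_altRows_eq (hσ : IsAssignment k σ) (ht : ¬ UsesRow σ t) :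
    (altRows σ τ t).card = (σ.filter (fun p => p.1 ∈ altRows σ τ t)).card + 1 := by
  have h1 : (σ.filter (fun p => p.1 ∈ altRows σ τ t)).card =
      ((σ.filter (fun p => p.1 ∈ altRows σ τ t)).image Prod.fst).card := by
    refine (Finset.card_image_of_injOn ?_).symm
    intro p hp q hq h
    exact hσ.eq_of_fst (Finset.mem_filter.1 hp).1 (Finset.mem_filter.1 hq).1 h
  have h2 : (σ.filter (fun p => p.1 ∈ altRows σ τ t)).image Prod.fst = (altRows σ τ t).erase t := by
    ext s
    simp only [Finset.mem_image, Finset.mem_filter, Finset.mem_erase]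
    constructor
    · rintro ⟨p, ⟨hp, hpU⟩, rfl⟩
      exact ⟨fun h => ht ⟨p, hp, h⟩, hpU⟩
    · rintro ⟨hst, hs⟩
      obtain ⟨p, hp, rfl⟩ := usesRow_of_mem_altRows hs hst
      exact ⟨p, ⟨hp, hs⟩, rfl⟩
  rw [h1, h2, Finset.card_erase_add_one self_mem_altRows]

open scoped Classical in
theorem card_filter_le_altRows (hτ : IsAssignment l τ) :
    (τ.filter (fun p => p.1 ∈ altRows σ τ t)).card ≤ (altRows σ τ t).card := by
  refine Finset.card_le_card_of_injOn Prod.fst (fun p hp => (Finset.mem_filter.1 hp).2) ?_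
  intro p hp q hq h
  exact hτ.eq_of_fst (Finset.mem_filter.1 hp).1 (Finset.mem_filter.1 hq).1 h

open scoped Classical in
theorem card_filter_eq_altRows (hτ : IsAssignment l τ) (h : ∀ s ∈ altRows σ τ t, UsesRow τ s) :
    (τ.filter (fun p => p.1 ∈ altRows σ τ t)).card = (altRows σ τ t).card := by
  refine le_antisymm (card_filter_le_altRows hτ) ?_
  have : altRows σ τ t ⊆ (τ.filter (fun p => p.1 ∈ altRows σ τ t)).image Prod.fst := by
    intro s hs
    obtain ⟨p, hp, rfl⟩ := h s hs
    exact Finset.mem_image.2 ⟨p, Finset.mem_filter.2 ⟨hp, hs⟩, rfl⟩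
  exact (Finset.card_le_card this).trans Finset.card_image_le

/-- Exchange along the alternating path that starts in a row used by `τ` only. -/
theorem exists_exchange (hσ : IsAssignment k σ) (hτ : IsAssignment l τ)
    (ht : UsesRow τ t) (ht' : ¬ UsesRow σ t) :
    ∃ σ' τ' : Finset (R × C), ((IsAssignment k σ' ∧ IsAssignment l τ') ∨
        (IsAssignment (k + 1) σ' ∧ IsAssignment (l - 1) τ' ∧ 1 ≤ l)) ∧
      UsesRow σ' t ∧ ¬ UsesRow τ' t ∧ (∀ j, UsesCol τ' j → UsesCol τ j) ∧
      ∀ x : R × C → ℝ, ∑ p ∈ σ', x p + ∑ p ∈ τ', x p = ∑ p ∈ σ, x p + ∑ p ∈ τ, x p := by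
  classical
  have hcσ := Finset.card_filter_add_card_filter_not (s := σ) (fun p => p.1 ∈ altRows σ τ t)
  have hcτ := Finset.card_filter_add_card_filter_not (s := τ) (fun p => p.1 ∈ altRows σ τ t)
  have h1 := card_altRows_filter_le (τ := τ) hσ ht'
  have h2 := card_altRows_eq (τ := τ) hσ ht'
  have h3 := card_filter_le_altRows (σ := σ) (t := t) hτ
  have hA := isAssignment_swapRows_altRows (t := t) hσ hτ
  have hB := isAssignment_swapRows_altRows' hσ hτ ht'
  have hkσ := hσ.1
  have hlτ := hτ.1
  have hcard := card_swapRows (altRows σ τ t) σ τ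
  have hcard' := card_swapRows (altRows σ τ t) τ σ
  refine ⟨swapRows (altRows σ τ t) σ τ, swapRows (altRows σ τ t) τ σ, ?_, ?_, ?_,
    fun j => usesCol_of_swapRows_altRows hσ ht', sum_swapRows_add _ σ τ⟩
  -- Within the path `σ` has one site fewer than there are rows, so `τ` has either as many sites as
  -- `σ` or exactly one more.
  · rcases eq_or_lt_of_le h1 with h | h
    · left
      have e1 : (swapRows (altRows σ τ t) σ τ).card = k := by omega
      have e2 : (swapRows (altRows σ τ t) τ σ).card = l := by omega
      exact ⟨e1 ▸ hA, e2 ▸ hB⟩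
    · right
      have e1 : (swapRows (altRows σ τ t) σ τ).card = k + 1 := by omega
      have e2 : (swapRows (altRows σ τ t) τ σ).card = l - 1 := by omega
      exact ⟨e1 ▸ hA, e2 ▸ hB, by omega⟩
  · obtain ⟨p, hp, rfl⟩ := ht
    exact ⟨p, mem_swapRows.2 (Or.inr ⟨hp, self_mem_altRows⟩), rfl⟩
  · rintro ⟨p, hp, rfl⟩
    rcases mem_swapRows.1 hp with ⟨-, h⟩ | ⟨h, -⟩
    · exact h self_mem_altRows
    · exact ht' ⟨p, h, rfl⟩

open scoped Classical in
/-- The rows used by `τ` only from which the alternating path is augmenting. -/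
def augRows (σ τ : Finset (R × C)) : Finset R :=
  Finset.univ.filter fun t => UsesRow τ t ∧ ¬ UsesRow σ t ∧ ∀ s ∈ altRows σ τ t, UsesRow τ s

theorem mem_augRows : t ∈ augRows σ τ ↔
    UsesRow τ t ∧ ¬ UsesRow σ t ∧ ∀ s ∈ altRows σ τ t, UsesRow τ s := by
  simp [augRows]

open scoped Classical in
theorem card_usesRow (hσ : IsAssignment k σ) : (Finset.univ.filter (UsesRow σ)).card = k := by
  rw [← hσ.1, ← Finset.card_image_of_injOn (s := σ) (f := Prod.fst)]
  · congr 1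
    ext s
    simp [UsesRow]
  · intro p hp q hq h
    exact hσ.eq_of_fst hp hq h

/-- A non-augmenting path from a row of `T \ S` reaches a row of `S \ T`. Paths with different
starts are disjoint, so at most `|S \ T|` starts are lost, while `|T \ S| - |S \ T| = l - k`. -/
theorem le_card_augRows (hσ : IsAssignment k σ) (hτ : IsAssignment l τ) :
    l ≤ k + (augRows σ τ).card := by
  classical
  set S := Finset.univ.filter (UsesRow σ) with hS
  set T := Finset.univ.filter (UsesRow τ) with hT
  have hSk : S.card = k := card_usesRow hσ
  have hTl : T.card = l := card_usesRow hτ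
  have hsub : augRows σ τ ⊆ T \ S := by
    intro t ht
    obtain ⟨h1, h2, -⟩ := mem_augRows.1 ht
    simp [hS, hT, h1, h2]
  have hbad : ((T \ S) \ augRows σ τ).card ≤ (S \ T).card := by
    have hex : ∀ t ∈ (T \ S) \ augRows σ τ, ∃ s ∈ altRows σ τ t, ¬ UsesRow τ s := by
      intro t ht
      simp only [Finset.mem_sdiff, mem_augRows, hS, hT, Finset.mem_filter, Finset.mem_univ,
        true_and] at ht
      by_contra! hcon
      exact ht.2 ⟨ht.1.1, ht.1.2, hcon⟩
    choose! f hf hf' using hex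
    have hT' : ∀ t ∈ (T \ S) \ augRows σ τ, UsesRow τ t ∧ ¬ UsesRow σ t := by
      intro t ht
      simp only [Finset.mem_sdiff, hS, hT, Finset.mem_filter, Finset.mem_univ, true_and] at ht
      exact ht.1
    refine Finset.card_le_card_of_injOn f ?_ ?_
    · intro t ht
      have hne : f t ≠ t := fun h => hf' t ht (h.symm ▸ (hT' t ht).1)
      simp only [Finset.coe_sdiff, Set.mem_sdiff, Finset.mem_coe, hS, hT, Finset.mem_filter,
        Finset.mem_univ, true_and]
      exact ⟨usesRow_of_mem_altRows (hf t ht) hne, hf' t ht⟩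
    · intro t ht t' ht' h
      exact altRows_disjoint hσ hτ (hT' t ht).2 (hT' t' ht').2 (hf t ht) (h ▸ hf t' ht')
  have h1 := Finset.card_sdiff_add_card_eq_card hsub
  have h2 := Finset.card_sdiff_add_card_inter T S
  have h3 := Finset.card_sdiff_add_card_inter S T
  rw [Finset.inter_comm] at h3
  omega

theorem augment (hσ : IsAssignment k σ) (hτ : IsAssignment l τ) (ht : t ∈ augRows σ τ) :
    IsAssignment (k + 1) (swapRows (altRows σ τ t) σ τ) ∧
      IsAssignment (l - 1) (swapRows (altRows σ τ t) τ σ) := by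
  classical
  obtain ⟨h1, h2, h3⟩ := mem_augRows.1 ht
  have hcσ := Finset.card_filter_add_card_filter_not (s := σ) (fun p => p.1 ∈ altRows σ τ t)
  have hcτ := Finset.card_filter_add_card_filter_not (s := τ) (fun p => p.1 ∈ altRows σ τ t)
  have h4 := card_altRows_eq (τ := τ) hσ h2
  have h5 := card_filter_eq_altRows hτ h3
  have hkσ := hσ.1
  have hlτ := hτ.1
  have hcard := card_swapRows (altRows σ τ t) σ τ
  have hcard' := card_swapRows (altRows σ τ t) τ σ
  have e1 : (swapRows (altRows σ τ t) σ τ).card = k + 1 := by omega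
  have e2 : (swapRows (altRows σ τ t) τ σ).card = l - 1 := by omega
  exact ⟨e1 ▸ isAssignment_swapRows_altRows hσ hτ, e2 ▸ isAssignment_swapRows_altRows' hσ hτ h2⟩

/-- An assignment can be augmented towards a larger one, the used rows remaining in use. -/
theorem exists_augment (hσ : IsAssignment k σ) (hτ : IsAssignment l τ) (hkl : k < l) :
    ∃ σ' τ' : Finset (R × C), IsAssignment (k + 1) σ' ∧ IsAssignment (l - 1) τ' ∧
      (∀ i, UsesRow σ i → UsesRow σ' i) ∧
      (∀ j, ¬ UsesCol σ j → ¬ UsesCol σ' j ∨ ¬ UsesCol τ' j) ∧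
      ∀ x : R × C → ℝ, ∑ p ∈ σ', x p + ∑ p ∈ τ', x p = ∑ p ∈ σ, x p + ∑ p ∈ τ, x p := by
  have hcard := le_card_augRows hσ hτ
  obtain ⟨t, ht⟩ : (augRows σ τ).Nonempty := Finset.card_pos.1 (by omega)
  obtain ⟨h1, h2⟩ := augment hσ hτ ht
  obtain ⟨-, -, h5⟩ := mem_augRows.1 ht
  refine ⟨_, _, h1, h2, ?_, ?_, sum_swapRows_add _ σ τ⟩
  · rintro _ ⟨p, hp, rfl⟩
    by_cases hpU : p.1 ∈ altRows σ τ t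
    · obtain ⟨q, hq, hqp⟩ := h5 _ hpU
      exact ⟨q, mem_swapRows.2 (Or.inr ⟨hq, hqp ▸ hpU⟩), hqp⟩
    · exact ⟨p, mem_swapRows.2 (Or.inl ⟨hp, hpU⟩), rfl⟩
  · intro j hj
    by_contra! hcon
    obtain ⟨⟨p, hp, hpj⟩, ⟨q, hq, hqj⟩⟩ := hcon
    -- Both sites in column `j` would come from `τ`, one inside and one outside the path, but `τ`
    -- has only one site there.
    rcases mem_swapRows.1 hp with ⟨hp, hpU⟩ | ⟨hp, hpU⟩
    · exact hj ⟨p, hp, hpj⟩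
    rcases mem_swapRows.1 hq with ⟨hq, hqU⟩ | ⟨hq, hqU⟩
    · exact hqU (hτ.eq_of_snd hq hp (hqj.trans hpj.symm) ▸ hpU)
    · exact hj ⟨q, hq, hqj⟩

/-- Augmentation towards an assignment with three more sites that retains a row of the larger one
and avoids a column. -/
theorem exists_augment_avoiding {a : R} {j : C} (hσ : IsAssignment k σ) (hτ : IsAssignment l τ)
    (hkl : k + 3 ≤ l) (ha : UsesRow τ a) (ha' : ¬ UsesRow σ a) (hj : ¬ UsesCol σ j) :
    ∃ σ' τ' : Finset (R × C), IsAssignment (k + 1) σ' ∧ IsAssignment (l - 1) τ' ∧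
      UsesRow τ' a ∧ ¬ UsesCol σ' j ∧
      ∀ x : R × C → ℝ, ∑ p ∈ σ', x p + ∑ p ∈ τ', x p = ∑ p ∈ σ, x p + ∑ p ∈ τ, x p := by
  classical
  have hcard := le_card_augRows hσ hτ
  -- At most one path carries the `τ`-site of column `j`. Of at least three augmenting starts, one
  -- remains after discarding that path's start and `a`.
  set B := (augRows σ τ).filter fun t => ∃ s ∈ altRows σ τ t, (s, j) ∈ τ with hB
  have hB1 : B.card ≤ 1 := by
    rw [Finset.card_le_one]
    intro t ht t' ht'
    obtain ⟨ht, s, hs, hsj⟩ := Finset.mem_filter.1 ht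
    obtain ⟨ht', s', hs', hsj'⟩ := Finset.mem_filter.1 ht'
    obtain rfl : s' = s := congrArg Prod.fst (hτ.eq_of_snd hsj' hsj rfl)
    exact altRows_disjoint hσ hτ (mem_augRows.1 ht).2.1 (mem_augRows.1 ht').2.1 hs hs'
  have hpos : 0 < ((augRows σ τ \ B).erase a).card := by
    have h1 := Finset.le_card_sdiff B (augRows σ τ)
    have h2 := Finset.pred_card_le_card_erase (s := augRows σ τ \ B) (a := a)
    omega
  obtain ⟨t, ht⟩ := Finset.card_pos.1 hpos
  obtain ⟨hta, ht⟩ := Finset.mem_erase.1 ht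
  obtain ⟨htA, htB⟩ := Finset.mem_sdiff.1 ht
  obtain ⟨h1, h2⟩ := augment hσ hτ htA
  refine ⟨_, _, h1, h2, ?_, ?_, sum_swapRows_add _ σ τ⟩
  · obtain ⟨p, hp, rfl⟩ := ha
    refine ⟨p, mem_swapRows.2 (Or.inl ⟨hp, fun h => ?_⟩), rfl⟩
    exact ha' (usesRow_of_mem_altRows h hta.symm)
  · rintro ⟨p, hp, rfl⟩
    rcases mem_swapRows.1 hp with ⟨hp, hpU⟩ | ⟨hp, hpU⟩
    · exact hj ⟨p, hp, rfl⟩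
    · exact htB (Finset.mem_filter.2 ⟨htA, p.1, hpU, hp⟩)

end Exchange

/-! ### Constrained minima and their gains -/

section Minima

variable {R C : Type*}

/-- The minimum of `∑ p ∈ π, x p` over the `k`-assignments `π` with the property `Q`. -/
def minAsg (Q : Finset (R × C) → Prop) (k : ℕ) (x : R × C → ℝ) : ℝ :=
  sInf {c : ℝ | ∃ π : Finset (R × C), IsAssignment k π ∧ Q π ∧ c = ∑ p ∈ π, x p}

/-- The minimum over all `k`-assignments. -/
abbrev minAll (k : ℕ) (x : R × C → ℝ) : ℝ := minAsg (fun _ => True) k x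

/-- The minimum over the `k`-assignments that avoid the column `j`. -/
abbrev minCol (j : C) (k : ℕ) (x : R × C → ℝ) : ℝ := minAsg (fun π => ¬ UsesCol π j) k x

/-- The minimum over the `k`-assignments that avoid the row `a`. -/
abbrev minRow (a : R) (k : ℕ) (x : R × C → ℝ) : ℝ := minAsg (fun π => ¬ UsesRow π a) k x

/-- The minimum over the `k`-assignments that avoid the row `a` and the column `j`. -/
abbrev minRowCol (a : R) (j : C) (k : ℕ) (x : R × C → ℝ) : ℝ :=
  minAsg (fun π => ¬ UsesRow π a ∧ ¬ UsesCol π j) k x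

/-- All entries are nonnegative, and every `k`-assignment that uses the row `a` is more expensive
than the cheapest one that does not. -/
def AvoidsRow (a : R) (k : ℕ) (x : R × C → ℝ) : Prop :=
  (∀ p, 0 ≤ x p) ∧ ∀ π, IsAssignment k π → UsesRow π a → minRow a k x < ∑ p ∈ π, x p

/-- The increase of the minimum `k + 1`-assignment upon deletion of a site in the column `j`. -/
def colGain (j : C) (k : ℕ) (x : R × C → ℝ) : ℝ := minAll (k + 1) x - minCol j k x

/-- `colGain` for assignments of size `k` instead of `k + 1`, zero if `k = 0`. -/
def prevGain (j : C) : ℕ → (R × C → ℝ) → ℝ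
  | 0, _ => 0
  | k + 1, x => colGain j k x

/-- `prevGain` computed within the assignments that avoid the row `a`. -/
def prevGainRow (a : R) (j : C) : ℕ → (R × C → ℝ) → ℝ
  | 0, _ => 0
  | k + 1, x => minRow a (k + 1) x - minRowCol a j k x

variable {Q : Finset (R × C) → Prop} {k : ℕ} {x : R × C → ℝ}

theorem minAsg_congr {y : R × C → ℝ}
    (h : ∀ π, IsAssignment k π → Q π → ∑ p ∈ π, x p = ∑ p ∈ π, y p) :
    minAsg Q k x = minAsg Q k y := by
  unfold minAsg
  congr 1
  ext c
  constructor
  · rintro ⟨π, h1, h2, rfl⟩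
    exact ⟨π, h1, h2, h π h1 h2⟩
  · rintro ⟨π, h1, h2, rfl⟩
    exact ⟨π, h1, h2, (h π h1 h2).symm⟩

theorem IsAssignment.exists_subset {k l : ℕ} {π : Finset (R × C)} (h : IsAssignment k π)
    (hl : l ≤ k) : ∃ ρ ⊆ π, IsAssignment l ρ := by
  obtain ⟨ρ, h1, h2⟩ := Finset.exists_subset_card_eq (h.1.symm ▸ hl)
  exact ⟨ρ, h1, h2 ▸ h.subset h1⟩

theorem UsesRow.mono {π ρ : Finset (R × C)} {a : R} (h : UsesRow ρ a) (hρ : ρ ⊆ π) :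
    UsesRow π a := by
  obtain ⟨p, hp, hpa⟩ := h
  exact ⟨p, hρ hp, hpa⟩

theorem UsesCol.mono {π ρ : Finset (R × C)} {j : C} (h : UsesCol ρ j) (hρ : ρ ⊆ π) :
    UsesCol π j := by
  obtain ⟨p, hp, hpj⟩ := h
  exact ⟨p, hρ hp, hpj⟩

theorem exists_avoiding_of_succ {a : R} {j : C} {k : ℕ}
    (h : ∃ π : Finset (R × C), IsAssignment (k + 1) π ∧ ¬ UsesRow π a ∧ ¬ UsesCol π j) :
    ∃ π : Finset (R × C), IsAssignment k π ∧ ¬ UsesRow π a ∧ ¬ UsesCol π j := by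
  obtain ⟨π, h1, h2, h3⟩ := h
  obtain ⟨ρ, hρ, h4⟩ := h1.exists_subset k.le_succ
  exact ⟨ρ, h4, fun h => h2 (h.mono hρ), fun h => h3 (h.mono hρ)⟩

theorem notMem_of_not_usesRow {π : Finset (R × C)} {a : R} {j : C} (h : ¬ UsesRow π a) : (a, j) ∉ π :=
  fun hp => h ⟨_, hp, rfl⟩

variable [Finite R] [Finite C]

theorem finite_costs (Q : Finset (R × C) → Prop) (k : ℕ) (x : R × C → ℝ) :
    {c : ℝ | ∃ π : Finset (R × C), IsAssignment k π ∧ Q π ∧ c = ∑ p ∈ π, x p}.Finite := by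
  refine (Set.finite_range (fun π : Finset (R × C) => ∑ p ∈ π, x p)).subset ?_
  rintro c ⟨π, -, -, rfl⟩
  exact ⟨π, rfl⟩

theorem minAsg_le {π : Finset (R × C)} (hπ : IsAssignment k π) (hQ : Q π) :
    minAsg Q k x ≤ ∑ p ∈ π, x p :=
  csInf_le (finite_costs Q k x).bddBelow ⟨π, hπ, hQ, rfl⟩

theorem exists_minAsg_eq (h : ∃ π, IsAssignment k π ∧ Q π) (x : R × C → ℝ) :
    ∃ π, IsAssignment k π ∧ Q π ∧ ∑ p ∈ π, x p = minAsg Q k x := by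
  obtain ⟨π, h1, h2⟩ := h
  obtain ⟨ρ, h3, h4, h5⟩ := Set.Nonempty.csInf_mem
    (s := {c : ℝ | ∃ π : Finset (R × C), IsAssignment k π ∧ Q π ∧ c = ∑ p ∈ π, x p})
    ⟨_, π, h1, h2, rfl⟩ (finite_costs Q k x)
  exact ⟨ρ, h3, h4, h5.symm⟩

theorem le_minAsg (h : ∃ π, IsAssignment k π ∧ Q π) {c : ℝ}
    (hc : ∀ π, IsAssignment k π → Q π → c ≤ ∑ p ∈ π, x p) : c ≤ minAsg Q k x := by
  obtain ⟨π, h1, h2, h3⟩ := exists_minAsg_eq h x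
  exact h3 ▸ hc π h1 h2

theorem AvoidsRow.minAll_eq {a : R} (hN : AvoidsRow a k x)
    (h : ∃ π : Finset (R × C), IsAssignment k π ∧ ¬ UsesRow π a) :
    minAll k x = minRow a k x := by
  obtain ⟨π, h1, h2, h3⟩ := exists_minAsg_eq h x
  refine le_antisymm ((minAsg_le h1 trivial).trans_eq h3) (le_minAsg ⟨π, h1, trivial⟩ ?_)
  intro ρ hρ _
  by_cases ha : UsesRow ρ a
  · exact (hN.2 ρ hρ ha).le
  · exact minAsg_le hρ ha

/-- If the cheapest `k`-assignment off column `j` used row `a`, exchanging it with the cheapest `k +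
1`-assignment off row `a` would give a `k + 1`-assignment through `a` that is too cheap. -/
theorem AvoidsRow.minCol_eq {a : R} {j : C} (hN : AvoidsRow a (k + 1) x)
    (h : ∃ π : Finset (R × C), IsAssignment (k + 1) π ∧ ¬ UsesRow π a ∧ ¬ UsesCol π j) :
    minCol j k x = minRowCol a j k x := by
  have := Fintype.ofFinite R
  have h' := exists_avoiding_of_succ h
  obtain ⟨ρ, hρ, hρj, hρm⟩ := exists_minAsg_eq
    (Q := fun π => ¬ UsesCol π j) (h'.imp fun π hπ => ⟨hπ.1, hπ.2.2⟩) x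
  obtain ⟨σ, hσ, hσa, hσm⟩ := exists_minAsg_eq
    (Q := fun π => ¬ UsesRow π a) (h.imp fun π hπ => ⟨hπ.1, hπ.2.1⟩) x
  refine le_antisymm (le_minAsg h' fun π h1 h2 => minAsg_le h1 h2.2) ?_
  by_cases hρa : UsesRow ρ a
  · exfalso
    obtain ⟨σ', ρ', hcard, h1, h2, h3, h4⟩ := exists_exchange hσ hρ hρa hσa
    rcases hcard with ⟨h5, h6⟩ | ⟨h5, h6, h7⟩
    · have h8 := hN.2 σ' h5 h1
      have h9 : minCol j k x ≤ _ := minAsg_le (x := x) h6 (fun h => hρj (h3 j h))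
      linarith [h4 x]
    -- The exchange has produced sizes `k + 2` and `k - 1`. The gap of three is what is needed to
    -- restore `k + 1` and `k` while retaining row `a` and avoiding column `j`.
    · obtain ⟨ρ'', σ'', g1, g2, g3, g4, g5⟩ :=
        exists_augment_avoiding h6 h5 (by omega) h1 h2 (fun h => hρj (h3 j h))
      rw [Nat.sub_add_cancel h7] at g1
      have h8 := hN.2 σ'' g2 g3
      have h9 : minCol j k x ≤ _ := minAsg_le (x := x) g1 g4
      linarith [h4 x, g5 x]
  · exact (minAsg_le hρ ⟨hρa, hρj⟩).trans_eq hρm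

theorem AvoidsRow.prevGain_eq {a : R} {j : C} (hN : AvoidsRow a k x)
    (h : ∃ π : Finset (R × C), IsAssignment k π ∧ ¬ UsesRow π a ∧ ¬ UsesCol π j) :
    prevGain j k x = prevGainRow a j k x := by
  cases k with
  | zero => rfl
  | succ k =>
    simp only [prevGain, prevGainRow, colGain]
    rw [hN.minCol_eq h, hN.minAll_eq (h.imp fun π hπ => ⟨hπ.1, hπ.2.1⟩)]

/-- Convexity in the size: augmenting the cheaper optimum off column `j` towards the larger overall
optimum gives two assignments of equal size, one of which still avoids `j`. -/
theorem prevGain_le_colGain {j : C} (hx : ∀ p, 0 ≤ x p)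
    (hj : ∃ π : Finset (R × C), IsAssignment k π ∧ ¬ UsesCol π j)
    (h : ∃ π : Finset (R × C), IsAssignment (k + 1) π) :
    prevGain j k x ≤ colGain j k x := by
  have := Fintype.ofFinite R
  cases k with
  | zero =>
    simp only [prevGain, colGain, sub_nonneg]
    have h0 : minCol j 0 x ≤ 0 := by
      have : IsAssignment 0 (∅ : Finset (R × C)) := ⟨rfl, by simp⟩
      simpa using minAsg_le (Q := fun π => ¬ UsesCol π j) (x := x) this (by simp [UsesCol])
    exact h0.trans (le_minAsg (h.imp fun π hπ => ⟨hπ, trivial⟩)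
      fun π _ _ => Finset.sum_nonneg fun p _ => hx p)
  | succ k =>
    simp only [prevGain, colGain]
    obtain ⟨τ, hτ, -, hτm⟩ := exists_minAsg_eq (Q := fun _ => True)
      (h.imp fun π hπ => ⟨hπ, trivial⟩) x
    have hj' : ∃ π : Finset (R × C), IsAssignment k π ∧ ¬ UsesCol π j := by
      obtain ⟨π, h1, h2⟩ := hj
      obtain ⟨ρ, hρ, h3⟩ := h1.exists_subset k.le_succ
      exact ⟨ρ, h3, fun h => h2 (h.mono hρ)⟩
    obtain ⟨ρ, hρ, hρj, hρm⟩ := exists_minAsg_eq hj' x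
    obtain ⟨σ', τ', h1, h2, -, h3, h4⟩ := exists_augment hρ hτ (by omega)
    have h4 := h4 x
    have h2 : IsAssignment (k + 1) τ' := h2
    rcases h3 j hρj with h5 | h5
    · have h6 : minCol j (k + 1) x ≤ _ := minAsg_le (x := x) h1 h5
      have h7 : minAll (k + 1) x ≤ _ := minAsg_le (x := x) h2 trivial
      linarith
    · have h6 : minCol j (k + 1) x ≤ _ := minAsg_le (x := x) h2 h5
      have h7 : minAll (k + 1) x ≤ _ := minAsg_le (x := x) h1 trivial
      linarith

theorem AvoidsRow.minCol_eq_or {a : R} {j : C} (hN : AvoidsRow a k x)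
    (h : ∃ π : Finset (R × C), IsAssignment k π ∧ ¬ UsesRow π a ∧ ¬ UsesCol π j) :
    minCol j k x = minRowCol a j k x ∨ colGain j k x ≤ prevGainRow a j k x := by
  have := Fintype.ofFinite R
  obtain ⟨τ, hτ, hτj, hτm⟩ := exists_minAsg_eq
    (Q := fun π => ¬ UsesCol π j) (h.imp fun π hπ => ⟨hπ.1, hπ.2.2⟩) x
  obtain ⟨σ, hσ, hσa, hσm⟩ := exists_minAsg_eq
    (Q := fun π => ¬ UsesRow π a) (h.imp fun π hπ => ⟨hπ.1, hπ.2.1⟩) x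
  by_cases hτa : UsesRow τ a
  · right
    obtain ⟨σ', τ', hcard, h1, h2, h3, h4⟩ := exists_exchange hσ hτ hτa hσa
    have h4 := h4 x
    rcases hcard with ⟨h5, h6⟩ | ⟨h5, h6, h7⟩
    · have h8 := hN.2 σ' h5 h1
      have h9 : minCol j k x ≤ _ := minAsg_le (x := x) h6 (fun h => hτj (h3 j h))
      linarith
    · obtain ⟨k, rfl⟩ : ∃ l, k = l + 1 := ⟨k - 1, by omega⟩
      simp only [prevGainRow, colGain]
      have h8 : minAll (k + 1 + 1) x ≤ _ := minAsg_le (x := x) h5 trivial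
      have h9 : minRowCol a j k x ≤ _ := minAsg_le (x := x) h6 ⟨h2, fun h => hτj (h3 j h)⟩
      linarith
  · left
    exact le_antisymm (le_minAsg h fun π h1 h2 => minAsg_le h1 h2.2)
      ((minAsg_le hτ ⟨hτa, hτj⟩).trans_eq hτm)

/-- In the first case of `minCol_eq_or` the second argument of the maximum is the difference itself.
In the second case monotonicity of gains forces the difference to vanish, and that argument is at
most `0`. -/
theorem AvoidsRow.colGain_sub_prevGain {a : R} {j : C} (hN : AvoidsRow a k x)
    (h : ∃ π : Finset (R × C), IsAssignment k π ∧ ¬ UsesRow π a ∧ ¬ UsesCol π j)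
    (h' : ∃ π : Finset (R × C), IsAssignment (k + 1) π) :
    colGain j k x - prevGain j k x =
      max 0 (minAll (k + 1) x - minRowCol a j k x - prevGainRow a j k x) := by
  have h1 := prevGain_le_colGain (j := j) hN.1 (h.imp fun π hπ => ⟨hπ.1, hπ.2.2⟩) h'
  have h2 := hN.prevGain_eq h
  have h3 : minCol j k x ≤ minRowCol a j k x := le_minAsg h fun π h1 h2 => minAsg_le h1 h2.2
  rcases hN.minCol_eq_or h with h4 | h4
  · rw [max_eq_right] <;> simp only [colGain] at * <;> linarith
  · rw [max_eq_left] <;> simp only [colGain] at * <;> linarith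

/-- Dropping a site, the one in column `j` if present, does not raise the cost. Row `a` plays no
role, so the bound holds before the entry `(a, j)` is chosen. -/
theorem prevGainRow_nonneg {a : R} {j : C} (hx : ∀ p : R × C, p.1 ≠ a → 0 ≤ x p)
    (h : ∃ π : Finset (R × C), IsAssignment k π ∧ ¬ UsesRow π a ∧ ¬ UsesCol π j) :
    0 ≤ prevGainRow a j k x := by
  classical
  cases k with
  | zero => exact le_rfl
  | succ k =>
    simp only [prevGainRow, sub_nonneg]
    refine le_minAsg (h.imp fun π hπ => ⟨hπ.1, hπ.2.1⟩) fun π h1 h2 => ?_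
    obtain ⟨q, hq, hqj⟩ : ∃ q ∈ π, ∀ p ∈ π.erase q, p.2 ≠ j := by
      by_cases hj : UsesCol π j
      · obtain ⟨q, hq, rfl⟩ := hj
        refine ⟨q, hq, fun p hp hpq => ?_⟩
        exact (Finset.mem_erase.1 hp).1 (h1.eq_of_snd (Finset.mem_erase.1 hp).2 hq hpq)
      · obtain ⟨q, hq⟩ := Finset.card_pos.1 (by rw [h1.1]; exact k.succ_pos)
        exact ⟨q, hq, fun p hp hpj => hj ⟨p, Finset.mem_of_mem_erase hp, hpj⟩⟩
    have h3 : IsAssignment k (π.erase q) := by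
      have := h1.subset (Finset.erase_subset q π)
      rwa [Finset.card_erase_of_mem hq, h1.1] at this
    have h4 : ¬ UsesCol (π.erase q) j := fun ⟨p, hp, hpj⟩ => hqj p hp hpj
    refine (minAsg_le h3 ⟨fun h => h2 (h.mono (Finset.erase_subset q π)), h4⟩).trans ?_
    · rw [← Finset.add_sum_erase π x hq]
      have := hx q fun h => h2 ⟨q, hq, h⟩
      linarith

end Minima

/-! ### Dependence on a single entry -/

section Update

variable {R C : Type*} [DecidableEq R] [DecidableEq C] {k : ℕ} {x : R × C → ℝ} {a : R} {j : C}

theorem sum_update_of_notMem {π : Finset (R × C)} {p : R × C} (hp : p ∉ π) (t : ℝ) :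
    ∑ q ∈ π, Function.update x p t q = ∑ q ∈ π, x q :=
  Finset.sum_congr rfl fun _ hq => Function.update_of_ne (ne_of_mem_of_not_mem hq hp) _ _

theorem sum_update_of_mem {π : Finset (R × C)} {p : R × C} (hp : p ∈ π) (t : ℝ) :
    ∑ q ∈ π, Function.update x p t q = t + ∑ q ∈ π.erase p, x q := by
  rw [← Finset.add_sum_erase π _ hp, Function.update_self,
    sum_update_of_notMem (Finset.notMem_erase p π)]

theorem IsAssignment.erase {π : Finset (R × C)} (h : IsAssignment (k + 1) π) (hp : (a, j) ∈ π) :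
    IsAssignment k (π.erase (a, j)) ∧ ¬ UsesRow (π.erase (a, j)) a ∧
      ¬ UsesCol (π.erase (a, j)) j := by
  have h1 := h.subset (Finset.erase_subset (a, j) π)
  rw [Finset.card_erase_of_mem hp, h.1] at h1
  refine ⟨h1, ?_, ?_⟩
  · rintro ⟨q, hq, hqa⟩
    exact (Finset.mem_erase.1 hq).1 (h.eq_of_fst (Finset.mem_erase.1 hq).2 hp hqa)
  · rintro ⟨q, hq, hqj⟩
    exact (Finset.mem_erase.1 hq).1 (h.eq_of_snd (Finset.mem_erase.1 hq).2 hp hqj)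

theorem IsAssignment.insert {π : Finset (R × C)} (h : IsAssignment k π) (ha : ¬ UsesRow π a)
    (hj : ¬ UsesCol π j) : IsAssignment (k + 1) (insert (a, j) π) := by
  refine ⟨by rw [Finset.card_insert_of_notMem (notMem_of_not_usesRow ha), h.1], ?_⟩
  have key : ∀ q ∈ π, a ≠ q.1 ∧ j ≠ q.2 := fun q hq =>
    ⟨fun h => ha ⟨q, hq, h.symm⟩, fun h => hj ⟨q, hq, h.symm⟩⟩
  intro p hp q hq hpq
  rcases Finset.mem_insert.1 hp with rfl | hp <;> rcases Finset.mem_insert.1 hq with rfl | hq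
  · exact absurd rfl hpq
  · exact key q hq
  · exact ⟨(key p hp).1.symm, (key p hp).2.symm⟩
  · exact h.2 p hp q hq hpq

theorem minRow_update (t : ℝ) : minRow a k (Function.update x (a, j) t) = minRow a k x :=
  minAsg_congr fun _ _ h => sum_update_of_notMem (notMem_of_not_usesRow h) t

theorem minRowCol_update (t : ℝ) :
    minRowCol a j k (Function.update x (a, j) t) = minRowCol a j k x :=
  minAsg_congr fun _ _ h => sum_update_of_notMem (notMem_of_not_usesRow h.1) t

theorem prevGainRow_update (t : ℝ) :
    prevGainRow a j k (Function.update x (a, j) t) = prevGainRow a j k x := by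
  cases k with
  | zero => rfl
  | succ k => simp only [prevGainRow, minRow_update, minRowCol_update]

variable [Finite R] [Finite C]

/-- The part of `AvoidsRow` that does not depend on the entry `(a, j)`. -/
def AvoidsRowElsewhere (a : R) (j : C) (k : ℕ) (x : R × C → ℝ) : Prop :=
  (∀ p, p ≠ (a, j) → 0 ≤ x p) ∧ ∀ π, IsAssignment k π → UsesRow π a → (a, j) ∉ π →
    minRow a k x < ∑ p ∈ π, x p

theorem avoidsRow_update_iff (t : ℝ)
    (h : ∃ π : Finset (R × C), IsAssignment k π ∧ ¬ UsesRow π a ∧ ¬ UsesCol π j) :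
    AvoidsRow a k (Function.update x (a, j) t) ↔
      AvoidsRowElsewhere a j k x ∧ 0 ≤ t ∧ (k = 0 ∨ prevGainRow a j k x < t) := by
  constructor
  · rintro ⟨h1, h2⟩
    refine ⟨⟨fun p hp => ?_, fun π hπ ha hp => ?_⟩, ?_, ?_⟩
    · simpa [Function.update_of_ne hp] using h1 p
    · have := h2 π hπ ha
      rwa [minRow_update, sum_update_of_notMem hp] at this
    · simpa using h1 (a, j)
    -- The cheapest assignment through `(a, j)` costs `t` plus a minimum one size smaller, which
    -- gives the threshold. For `k = 0` no assignment contains the site, so there is no threshold.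
    · cases k with
      | zero => exact Or.inl rfl
      | succ k =>
        right
        obtain ⟨π, hπ, ⟨hπa, hπj⟩, hπm⟩ := exists_minAsg_eq
          (Q := fun π => ¬ UsesRow π a ∧ ¬ UsesCol π j) (exists_avoiding_of_succ h) x
        have h3 := h2 _ (hπ.insert hπa hπj) ⟨_, Finset.mem_insert_self _ _, rfl⟩
        rw [minRow_update, sum_update_of_mem (Finset.mem_insert_self _ _),
          Finset.erase_insert (notMem_of_not_usesRow hπa), hπm] at h3
        simp only [prevGainRow]
        linarith
  · rintro ⟨⟨h1, h2⟩, h3, h4⟩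
    refine ⟨fun p => ?_, fun π hπ ha => ?_⟩
    · by_cases hp : p = (a, j)
      · simpa [hp] using h3
      · simpa [Function.update_of_ne hp] using h1 p hp
    · rw [minRow_update]
      by_cases hp : (a, j) ∈ π
      · cases k with
        | zero => exact absurd (Finset.card_pos.2 ⟨_, hp⟩) (by simp [hπ.1])
        | succ k =>
          have h5 := h4.resolve_left k.succ_ne_zero
          simp only [prevGainRow] at h5
          obtain ⟨e1, e2⟩ := hπ.erase hp
          have h6 : minRowCol a j k x ≤ _ := minAsg_le (x := x) e1 e2
          rw [sum_update_of_mem hp]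
          linarith
      · rw [sum_update_of_notMem hp]
        exact h2 π hπ ha hp

theorem minAsg_mem_update (t : ℝ)
    (h : ∃ π : Finset (R × C), IsAssignment k π ∧ ¬ UsesRow π a ∧ ¬ UsesCol π j) :
    minAsg (fun π => (a, j) ∈ π) (k + 1) (Function.update x (a, j) t) =
      t + minRowCol a j k x := by
  obtain ⟨π, hπ, ⟨hπa, hπj⟩, hπm⟩ := exists_minAsg_eq
    (Q := fun π => ¬ UsesRow π a ∧ ¬ UsesCol π j) h x
  have hmem : (a, j) ∈ insert (a, j) π := Finset.mem_insert_self _ _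
  refine le_antisymm ?_ ?_
  · refine (minAsg_le (Q := fun π => (a, j) ∈ π) (hπ.insert hπa hπj) hmem).trans_eq ?_
    rw [sum_update_of_mem (Finset.mem_insert_self _ _),
      Finset.erase_insert (notMem_of_not_usesRow hπa), hπm]
  · refine le_minAsg ⟨_, hπ.insert hπa hπj, hmem⟩ fun ρ hρ hp => ?_
    obtain ⟨e1, e2⟩ := hρ.erase hp
    rw [sum_update_of_mem hp]
    exact add_le_add_right (minAsg_le e1 e2) t

/-- Assignments through `(a, j)` contribute `t` plus a constant, all others a constant. If there are
no others, the second minimum would be the default `sInf ∅ = 0`; hence the separate alternative. -/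
theorem minAll_update (x : R × C → ℝ)
    (h : ∃ π : Finset (R × C), IsAssignment k π ∧ ¬ UsesRow π a ∧ ¬ UsesCol π j) :
    (∀ t, minAll (k + 1) (Function.update x (a, j) t) = t + minRowCol a j k x) ∨
      ∃ d, ∀ t, minAll (k + 1) (Function.update x (a, j) t) = min (t + minRowCol a j k x) d := by
  have hmem : ∃ π : Finset (R × C), IsAssignment (k + 1) π ∧ (a, j) ∈ π := by
    obtain ⟨π, hπ, hπa, hπj⟩ := h
    exact ⟨_, hπ.insert hπa hπj, Finset.mem_insert_self _ _⟩
  have hall : ∃ π : Finset (R × C), IsAssignment (k + 1) π ∧ True :=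
    hmem.imp fun π hπ => ⟨hπ.1, trivial⟩
  by_cases hne : ∃ π : Finset (R × C), IsAssignment (k + 1) π ∧ (a, j) ∉ π
  · right
    refine ⟨minAsg (fun π => (a, j) ∉ π) (k + 1) x, fun t => ?_⟩
    have hd : minAsg (fun π => (a, j) ∉ π) (k + 1) x =
        minAsg (fun π => (a, j) ∉ π) (k + 1) (Function.update x (a, j) t) :=
      minAsg_congr fun π _ hp => (sum_update_of_notMem hp t).symm
    rw [← minAsg_mem_update t h, hd]
    refine le_antisymm (le_min ?_ ?_) (le_minAsg hall fun π hπ _ => ?_)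
    · exact le_minAsg hmem fun π hπ _ => minAsg_le hπ trivial
    · exact le_minAsg hne fun π hπ _ => minAsg_le hπ trivial
    · by_cases hp : (a, j) ∈ π
      · exact (min_le_left _ _).trans (minAsg_le hπ hp)
      · exact (min_le_right _ _).trans (minAsg_le hπ hp)
  · left
    intro t
    rw [← minAsg_mem_update t h]
    push Not at hne
    exact le_antisymm (le_minAsg hmem fun π hπ _ => minAsg_le hπ trivial)
      (le_minAsg hall fun π hπ _ => minAsg_le hπ (hne π hπ))

end Update

/-! ### The exponential law -/

section Exponential

open scoped ENNReal

instance isProbabilityMeasure_expMeasure_one : IsProbabilityMeasure (expMeasure 1) :=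
  isProbabilityMeasure_expMeasure one_pos

theorem expMeasure_absolutelyContinuous (r : ℝ) : expMeasure r ≪ volume :=
  withDensity_absolutelyContinuous _ _

instance nullSingletonClass_expMeasure (r : ℝ) : NullSingletonClass (expMeasure r) :=
  ⟨fun x => expMeasure_absolutelyContinuous r (measure_singleton x)⟩

theorem expMeasure_Ioi {s : ℝ} (hs : 0 ≤ s) :
    expMeasure 1 (Set.Ioi s) = ENNReal.ofReal (Real.exp (-s)) := by
  have h := cdf_expMeasure_eq one_pos s
  rw [if_pos hs, one_mul, cdf_eq_real] at h
  rw [← Set.compl_Iic, ← ofReal_measureReal, probReal_compl_eq_one_sub measurableSet_Iic, h]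
  congr 1
  ring

/-- At rate `1` the density at `t ≥ 0` equals the tail beyond `t`. -/
theorem expMeasure_eq_lintegral {s : Set ℝ} (hs : MeasurableSet s) (h0 : s ⊆ Set.Ioi 0) :
    expMeasure 1 s = ∫⁻ t in s, expMeasure 1 (Set.Ioi t) := by
  have h1 : expMeasure 1 s = ∫⁻ t in s, exponentialPDF 1 t := withDensity_apply _ hs
  rw [h1]
  refine setLIntegral_congr_fun hs fun t ht => ?_
  have ht0 : 0 ≤ t := (h0 ht).le
  rw [exponentialPDF_of_nonneg ht0, expMeasure_Ioi ht0]
  simp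

theorem ae_nonneg_expMeasure : ∀ᵐ t ∂(expMeasure 1), 0 ≤ t := by
  rw [ae_iff]
  have h : {t : ℝ | ¬ 0 ≤ t} = (Set.Ioi 0 ∪ {0})ᶜ := by
    ext t
    simp only [Set.mem_ofPred_eq, not_le, Set.mem_compl_iff, Set.mem_union, Set.mem_Ioi,
      Set.mem_singleton_iff, not_or, not_lt]
    exact ⟨fun h => ⟨h.le, h.ne⟩, fun h => lt_of_le_of_ne h.1 h.2⟩
  rw [h, prob_compl_eq_zero_iff (by measurability)]
  refine le_antisymm prob_le_one ?_
  calc (1 : ℝ≥0∞) = expMeasure 1 (Set.Ioi 0) := by simp [expMeasure_Ioi]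
    _ ≤ _ := measure_mono Set.subset_union_left

/-- The memoryless property in integrated form. -/
theorem lintegral_volume_inter_Iio {s : Set ℝ} (hs : MeasurableSet s) (h0 : s ⊆ Set.Ioi 0) :
    ∫⁻ t, volume (s ∩ Set.Iio t) ∂(expMeasure 1) = expMeasure 1 s := by
  have h1 : ∀ t : ℝ, volume (s ∩ Set.Iio t) =
      ∫⁻ u in s, (Set.Ioi u).indicator (fun _ => (1 : ℝ≥0∞)) t := by
    intro t
    have : (fun u : ℝ => (Set.Ioi u).indicator (fun _ => (1 : ℝ≥0∞)) t) =
        (Set.Iio t).indicator 1 := by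
      ext u
      simp [Set.indicator_apply]
    rw [this, lintegral_indicator_one measurableSet_Iio, Measure.restrict_apply measurableSet_Iio,
      Set.inter_comm]
  simp_rw [h1]
  rw [lintegral_lintegral_swap, expMeasure_eq_lintegral hs h0]
  · refine lintegral_congr fun u => ?_
    exact lintegral_indicator_one measurableSet_Ioi
  · have : (Function.uncurry fun (t u : ℝ) => (Set.Ioi u).indicator (fun _ => (1 : ℝ≥0∞)) t) =
        {z : ℝ × ℝ | z.2 < z.1}.indicator 1 := by
      ext z
      simp [Set.indicator_apply, Function.uncurry]
    rw [this]
    exact (measurable_one.indicator (measurableSet_lt measurable_snd measurable_fst)).aemeasurable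

/-- The excess `max 0 (min t w - v)` is the length of the part of `(v, w]` below `t`, so
`lintegral_volume_inter_Iio` applies. -/
theorem lintegral_truncated_excess {φ : ℝ → ℝ} {v : ℝ} (hv : 0 ≤ v)
    (hφ : (∀ t, φ t = t) ∨ ∃ w, ∀ t, φ t = min t w) :
    ∫⁻ t, ENNReal.ofReal (max 0 (φ t - v)) ∂(expMeasure 1) =
      expMeasure 1 {t | v < t ∧ φ t = t} := by
  have hφm : Measurable φ := by
    rcases hφ with h | ⟨w, h⟩
    · simpa only [funext h] using measurable_id'
    · rw [funext h]
      fun_prop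
  have hm : MeasurableSet {t | v < t ∧ φ t = t} :=
    (measurableSet_lt measurable_const measurable_id).inter
      (measurableSet_eq_fun hφm measurable_id)
  rw [← lintegral_volume_inter_Iio hm fun t ht => hv.trans_lt ht.1]
  refine lintegral_congr fun t => ?_
  rcases hφ with h | ⟨w, h⟩
  · have : {t | v < t ∧ φ t = t} ∩ Set.Iio t = Set.Ioo v t := by
      ext u
      simp [h]
    rw [this, Real.volume_Ioo, h, ENNReal.ofReal_max]
    simp
  · rcases le_total t w with htw | htw
    · have : {t | v < t ∧ φ t = t} ∩ Set.Iio t = Set.Ioo v t := by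
        ext u
        simp only [h, Set.mem_inter_iff, Set.mem_ofPred_eq, min_eq_left_iff, Set.mem_Iio,
          Set.mem_Ioo]
        exact ⟨fun hu => ⟨hu.1.1, hu.2⟩, fun hu => ⟨⟨hu.1, hu.2.le.trans htw⟩, hu.2⟩⟩
      rw [this, Real.volume_Ioo, h, min_eq_left htw, ENNReal.ofReal_max]
      simp
    · have h1 : Set.Ioo v w ⊆ {t | v < t ∧ φ t = t} ∩ Set.Iio t := by
        intro u hu
        exact ⟨⟨hu.1, by rw [h, min_eq_left hu.2.le]⟩, hu.2.trans_le htw⟩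
      have h2 : {t | v < t ∧ φ t = t} ∩ Set.Iio t ⊆ Set.Ioc v w := by
        rintro u ⟨⟨hu, hu'⟩, -⟩
        rw [h] at hu'
        exact ⟨hu, min_eq_left_iff.1 hu'⟩
      have h3 : volume ({t | v < t ∧ φ t = t} ∩ Set.Iio t) = ENNReal.ofReal (w - v) :=
        le_antisymm ((measure_mono h2).trans_eq Real.volume_Ioc)
          (Real.volume_Ioo.symm.trans_le (measure_mono h1))
      rw [h3, h, min_eq_right htw, ENNReal.ofReal_max]
      simp

/-- The truncated excess with `v = 0` and no truncation: the mean is itself a probability. -/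
theorem integrable_id_expMeasure : Integrable (fun t : ℝ => t) (expMeasure 1) := by
  refine ⟨measurable_id.aestronglyMeasurable, ?_⟩
  rw [hasFiniteIntegral_iff_ofReal ae_nonneg_expMeasure]
  have h := lintegral_truncated_excess (φ := fun t => t) le_rfl (Or.inl fun _ => rfl)
  simp only [sub_zero, ENNReal.ofReal_max, ENNReal.ofReal_zero, zero_le, max_eq_right] at h
  rw [h]
  exact measure_lt_top _ _

end Exponential

/-! ### Integrating out one entry -/

section Marginal

open scoped ENNReal

variable {R C : Type*}

theorem measurable_sum_apply (π : Finset (R × C)) :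
    Measurable fun x : R × C → ℝ => ∑ p ∈ π, x p :=
  Finset.measurable_fun_sum _ fun p _ => measurable_pi_apply p

variable [Fintype R] [Fintype C]

theorem measurable_minAsg (Q : Finset (R × C) → Prop) (k : ℕ) : Measurable (minAsg Q k) := by
  classical
  by_cases h : ∃ π : Finset (R × C), IsAssignment k π ∧ Q π
  · have hne : (Finset.univ.filter fun π : Finset (R × C) => IsAssignment k π ∧ Q π).Nonempty := by
      obtain ⟨π, hπ⟩ := h
      exact ⟨π, by simpa using hπ⟩
    have : minAsg Q k = (Finset.univ.filter fun π => IsAssignment k π ∧ Q π).inf' hne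
        fun π x => ∑ p ∈ π, x p := by
      ext x
      rw [Finset.inf'_apply]
      refine le_antisymm (Finset.le_inf' _ _ fun π hπ => ?_) (le_minAsg h fun π h1 h2 => ?_)
      · exact minAsg_le (by simpa using (Finset.mem_filter.1 hπ).2.1) (Finset.mem_filter.1 hπ).2.2
      · exact Finset.inf'_le (f := fun π => ∑ p ∈ π, x p) (by simpa using ⟨h1, h2⟩)
    rw [this]
    exact Finset.inf'_induction hne _ (fun _ h1 _ h2 => h1.inf h2) fun π _ => measurable_sum_apply π
  · have : minAsg Q k = fun _ => 0 := by
      ext x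
      have he : {c : ℝ | ∃ π : Finset (R × C), IsAssignment k π ∧ Q π ∧ c = ∑ p ∈ π, x p} = ∅ := by
        rw [Set.eq_empty_iff_forall_notMem]
        rintro c ⟨π, h1, h2, -⟩
        exact h ⟨π, h1, h2⟩
      rw [minAsg, he, Real.sInf_empty]
    rw [this]
    exact measurable_const

theorem measurable_colGain (j : C) (k : ℕ) : Measurable (colGain (R := R) j k) :=
  (measurable_minAsg _ _).sub (measurable_minAsg _ _)

theorem measurable_prevGain (j : C) (k : ℕ) : Measurable (prevGain (R := R) j k) := by
  cases k with
  | zero => exact measurable_const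
  | succ k => exact measurable_colGain j k

theorem measurableSet_avoidsRow (a : R) (k : ℕ) :
    MeasurableSet {x : R × C → ℝ | AvoidsRow a k x} := by
  have h1 : MeasurableSet {x : R × C → ℝ | ∀ p, 0 ≤ x p} := by
    rw [Set.ofPred_forall]
    exact MeasurableSet.iInter fun p => measurableSet_le measurable_const (measurable_pi_apply p)
  have h2 : MeasurableSet {x : R × C → ℝ | ∀ π, IsAssignment k π → UsesRow π a →
      minRow a k x < ∑ p ∈ π, x p} := by
    simp only [Set.ofPred_forall]
    exact MeasurableSet.iInter fun π => MeasurableSet.iInter fun _ => MeasurableSet.iInter fun _ =>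
      measurableSet_lt (measurable_minAsg _ _) (measurable_sum_apply π)
  exact h1.inter h2

theorem measurableSet_minAsg_mem (a : R) (j : C) (k : ℕ) :
    MeasurableSet {x : R × C → ℝ | minAsg (fun π => (a, j) ∈ π) k x = minAll k x} :=
  measurableSet_eq_fun (measurable_minAsg _ _) (measurable_minAsg _ _)

variable (R C) in
/-- The law of a matrix of independent exponential variables of rate `1`. -/
abbrev expPi : Measure (R × C → ℝ) := Measure.pi fun _ => expMeasure 1

/-- The expected gain in column `j` while row `a` is avoided is the probability that the
next assignment enters row `a` in column `j`. -/
theorem lintegral_gain_eq_measure (a : R) (j : C) (k : ℕ)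
    (h : ∃ π : Finset (R × C), IsAssignment k π ∧ ¬ UsesRow π a ∧ ¬ UsesCol π j) :
    ∫⁻ x, {x | AvoidsRow a k x}.indicator
        (fun x => ENNReal.ofReal (colGain j k x - prevGain j k x)) x ∂(expPi R C) =
      ∫⁻ x, ({x | AvoidsRow a k x} ∩
        {x | minAsg (fun π => (a, j) ∈ π) (k + 1) x = minAll (k + 1) x}).indicator 1 x
          ∂(expPi R C) := by
  classical
  refine lintegral_eq_of_lmarginal_eq {(a, j)} ?_ ?_ ?_
  · exact ((measurable_colGain j k).sub (measurable_prevGain j k)).ennreal_ofReal.indicator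
      (measurableSet_avoidsRow a k)
  · exact measurable_one.indicator
      ((measurableSet_avoidsRow a k).inter (measurableSet_minAsg_mem a j (k + 1)))
  rw [lmarginal_singleton, lmarginal_singleton]
  funext x
  have h' : ∃ π : Finset (R × C), IsAssignment (k + 1) π := by
    obtain ⟨π, hπ, hπa, hπj⟩ := h
    exact ⟨_, hπ.insert hπa hπj⟩
  by_cases hE : AvoidsRowElsewhere a j k x
  swap
  · have hN : ∀ t, ¬ AvoidsRow a k (Function.update x (a, j) t) := fun t ht =>
      hE ((avoidsRow_update_iff t h).1 ht).1
    refine lintegral_congr fun t => ?_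
    rw [Set.indicator_of_notMem, Set.indicator_of_notMem]
    · exact fun ht => hN t ht.1
    · exact hN t
  have hN : ∀ t, AvoidsRow a k (Function.update x (a, j) t) ↔
      0 ≤ t ∧ (k = 0 ∨ prevGainRow a j k x < t) := fun t => by
    rw [avoidsRow_update_iff t h]
    exact and_iff_right hE
  set v := prevGainRow a j k x with hvdef
  have hv : 0 ≤ v := prevGainRow_nonneg (fun p hp => hE.1 p fun h => hp (by rw [h])) h
  have hv0 : k = 0 → v = 0 := by
    rintro rfl
    rfl
  set φ : ℝ → ℝ := fun t => minAll (k + 1) (Function.update x (a, j) t) - minRowCol a j k x with hφdef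
  have hφ : (∀ t, φ t = t) ∨ ∃ w, ∀ t, φ t = min t w := by
    rcases minAll_update x h with h1 | ⟨d, h1⟩
    · left
      intro t
      simp only [hφdef, h1]
      ring
    · right
      refine ⟨d - minRowCol a j k x, fun t => ?_⟩
      simp only [hφdef, h1]
      rw [← min_sub_sub_right, add_sub_cancel_right]
  have hφle : ∀ t, φ t ≤ t := by
    intro t
    rcases hφ with h1 | ⟨w, h1⟩
    · exact (h1 t).le
    · exact h1 t ▸ min_le_left _ _
  trans ∫⁻ t, ENNReal.ofReal (max 0 (φ t - v)) ∂(expMeasure 1)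
  · refine lintegral_congr fun t => ?_
    by_cases ht : AvoidsRow a k (Function.update x (a, j) t)
    · rw [Set.indicator_of_mem (s := {x | AvoidsRow a k x}) ht, ht.colGain_sub_prevGain h h',
        minRowCol_update, prevGainRow_update]
    · rw [Set.indicator_of_notMem (s := {x | AvoidsRow a k x}) ht, max_eq_left,
        ENNReal.ofReal_zero]
      -- Off the event either `t < 0 ≤ v` or `t ≤ v`, so the truncated excess is zero as well.
      rw [hN, not_and_or, not_or, not_le, not_lt] at ht
      have := hφle t
      rcases ht with ht | ⟨-, ht⟩ <;> linarith
  · rw [lintegral_truncated_excess hv hφ]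
    have hφm : Measurable φ := by
      rcases hφ with h | ⟨w, h⟩
      · simpa only [funext h] using measurable_id'
      · rw [funext h]
        fun_prop
    have hm : MeasurableSet {t | v < t ∧ φ t = t} :=
      (measurableSet_lt measurable_const measurable_id).inter
        (measurableSet_eq_fun hφm measurable_id)
    rw [← lintegral_indicator_one hm]
    refine lintegral_congr_ae ?_
    -- For `k = 0` the event allows `t = v = 0`, which the strict inequality does not; a single
    -- point is null.
    have hne : ∀ᵐ t ∂(expMeasure 1), t ≠ v := by simp [ae_iff]
    filter_upwards [hne] with t ht
    simp only [Set.indicator_apply, Set.mem_inter_iff, Set.mem_ofPred_eq, Pi.one_apply]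
    refine if_congr ?_ rfl rfl
    rw [hN, minAsg_mem_update t h]
    have e : φ t = t ↔ t + minRowCol a j k x = minAll (k + 1) (Function.update x (a, j) t) := by
      simp only [hφdef]
      constructor <;> intro h <;> linarith
    rw [← e]
    refine and_congr_left fun _ => ⟨fun h => ⟨hv.trans h.le, Or.inr h⟩, ?_⟩
    rintro ⟨h1, h2 | h2⟩
    · exact lt_of_le_of_ne (hv0 h2 ▸ h1) ht.symm
    · exact h2

end Marginal

/-! ### Generic matrices and summation over sites -/

section Generic

open scoped ENNReal

variable {R C : Type*}

/-- All entries are nonnegative, and distinct sets of sites have distinct costs. -/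
def IsGeneric (x : R × C → ℝ) : Prop :=
  (∀ p, 0 ≤ x p) ∧ ∀ π ρ : Finset (R × C), ∑ p ∈ π, x p = ∑ p ∈ ρ, x p → π = ρ

variable [Fintype R]

open scoped Classical in
theorem card_filter_new_row {k : ℕ} {σ τ : Finset (R × C)} (hσ : IsAssignment k σ) (hτ : IsAssignment (k + 1) τ)
    (h : ∀ i, UsesRow σ i → UsesRow τ i) :
    (τ.filter fun p => ¬ UsesRow σ p.1).card = 1 := by
  have h1 := Finset.card_filter_add_card_filter_not (s := τ) (fun p => UsesRow σ p.1)
  have h2 : (τ.filter fun p => UsesRow σ p.1).card = k := by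
    rw [← card_usesRow hσ, ← Finset.card_image_of_injOn (f := Prod.fst)
      (s := τ.filter fun p => UsesRow σ p.1)]
    · congr 1
      ext i
      simp only [Finset.mem_image, Finset.mem_filter, Finset.mem_univ, true_and]
      constructor
      · rintro ⟨p, ⟨-, hp⟩, rfl⟩
        exact hp
      · intro hi
        obtain ⟨p, hp, rfl⟩ := h i hi
        exact ⟨p, ⟨hp, hi⟩, rfl⟩
    · intro p hp q hq hpq
      exact hτ.eq_of_fst (Finset.mem_filter.1 hp).1 (Finset.mem_filter.1 hq).1 hpq
  have h3 := hτ.1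
  omega

variable [Fintype C]

/-- Given the other entries, equal costs pin the entry at `p` to one value. -/
theorem expPi_sum_eq_null {π ρ : Finset (R × C)} {p : R × C} (hp : p ∈ π) (hp' : p ∉ ρ) :
    expPi R C {x | ∑ q ∈ π, x q = ∑ q ∈ ρ, x q} = 0 := by
  classical
  have hm : MeasurableSet {x : R × C → ℝ | ∑ q ∈ π, x q = ∑ q ∈ ρ, x q} :=
    measurableSet_eq_fun (measurable_sum_apply π) (measurable_sum_apply ρ)
  rw [← lintegral_indicator_one hm, ← lintegral_zero (μ := expPi R C)]
  refine lintegral_eq_of_lmarginal_eq {p} (measurable_one.indicator hm) measurable_const ?_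
  rw [lmarginal_singleton, lmarginal_singleton]
  funext x
  refine lintegral_congr_ae ?_
  have hne : ∀ᵐ t ∂(expMeasure 1), t ≠ ∑ q ∈ ρ, x q - ∑ q ∈ π.erase p, x q := by simp [ae_iff]
  filter_upwards [hne] with t ht
  refine Set.indicator_of_notMem (fun h => ht ?_) _
  have h : ∑ q ∈ π, Function.update x p t q = ∑ q ∈ ρ, Function.update x p t q := h
  rw [sum_update_of_mem hp, sum_update_of_notMem hp'] at h
  linarith

theorem ae_isGeneric : ∀ᵐ x ∂(expPi R C), IsGeneric x := by
  classical
  refine Filter.Eventually.and ?_ ?_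
  · rw [ae_all_iff]
    intro p
    exact (Measure.quasiMeasurePreserving_eval (fun _ : R × C => expMeasure 1) p).ae
      ae_nonneg_expMeasure
  · simp only [ae_all_iff]
    intro π ρ
    by_cases h : π = ρ
    · exact Filter.Eventually.of_forall fun x _ => h
    · have hnull : expPi R C {x | ∑ q ∈ π, x q = ∑ q ∈ ρ, x q} = 0 := by
        by_cases hsub : π ⊆ ρ
        · obtain ⟨p, hp, hp'⟩ := Finset.not_subset.1 fun h' => h (hsub.antisymm h')
          simpa only [eq_comm] using expPi_sum_eq_null hp hp'
        · obtain ⟨p, hp, hp'⟩ := Finset.not_subset.1 hsub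
          exact expPi_sum_eq_null hp hp'
      have := measure_eq_zero_iff_ae_notMem.1 hnull
      filter_upwards [this] with x hx hx'
      exact absurd hx' hx

variable {k : ℕ} {x : R × C → ℝ} {σ τ : Finset (R × C)}

theorem IsGeneric.avoidsRow_iff (hx : IsGeneric x) {a : R}
    (ha : ∃ π : Finset (R × C), IsAssignment k π ∧ ¬ UsesRow π a)
    (hσ : IsAssignment k σ) (hσm : ∑ p ∈ σ, x p = minAll k x) :
    AvoidsRow a k x ↔ ¬ UsesRow σ a := by
  constructor
  · intro h hu
    have h1 := h.2 σ hσ hu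
    rw [hσm, h.minAll_eq ha] at h1
    exact h1.false
  · intro h
    refine ⟨hx.1, fun π hπ hu => ?_⟩
    have h1 : minRow a k x ≤ _ := minAsg_le (x := x) hσ h
    have h2 : minAll k x ≤ _ := minAsg_le (x := x) hπ trivial
    refine lt_of_le_of_ne (h1.trans (hσm.trans_le h2)) fun h3 => ?_
    have h4 : σ = π := hx.2 σ π (le_antisymm (hσm.trans_le h2) (h3 ▸ h1))
    exact h (h4 ▸ hu)

theorem IsGeneric.minAsg_mem_eq_iff (hx : IsGeneric x) {p : R × C}
    (hp : ∃ π : Finset (R × C), IsAssignment k π ∧ p ∈ π)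
    (hσ : IsAssignment k σ) (hσm : ∑ p ∈ σ, x p = minAll k x) :
    minAsg (fun π => p ∈ π) k x = minAll k x ↔ p ∈ σ := by
  constructor
  · intro h
    obtain ⟨π, -, h2, h3⟩ := exists_minAsg_eq hp x
    rwa [hx.2 σ π (by rw [hσm, ← h, h3])]
  · intro h
    refine le_antisymm ((minAsg_le hσ h).trans_eq hσm) ?_
    exact le_minAsg hp fun π hπ _ => minAsg_le hπ trivial

/-- The rows used by the optimal `k`-assignment are used by the optimal `k + 1`-assignment. -/
theorem IsGeneric.usesRow_mono (hx : IsGeneric x)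
    (hσ : IsAssignment k σ) (hσm : ∑ p ∈ σ, x p = minAll k x)
    (hτ : IsAssignment (k + 1) τ) (hτm : ∑ p ∈ τ, x p = minAll (k + 1) x) {i : R}
    (hi : UsesRow σ i) : UsesRow τ i := by
  obtain ⟨σ', τ', h1, h2, h3, -, h4⟩ := exists_augment hσ hτ k.lt_succ_self
  have h5 : minAll (k + 1) x ≤ _ := minAsg_le (x := x) h1 trivial
  have h6 : minAll k x ≤ _ := minAsg_le (x := x) h2 trivial
  -- The two total costs agree and neither new assignment beats the optimum of its size, so both are
  -- optimal.
  have h7 : σ' = τ := hx.2 _ _ (by linarith [h4 x])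
  exact h7 ▸ h3 i hi

open scoped Classical in
theorem IsGeneric.sum_indicator_avoidsRow (hx : IsGeneric x)
    (hk : ∀ a : R, ∃ π : Finset (R × C), IsAssignment k π ∧ ¬ UsesRow π a)
    (hk' : ∃ π : Finset (R × C), IsAssignment k π) (c : ℝ≥0∞) :
    ∑ a : R, {x | AvoidsRow a k x}.indicator (fun _ => c) x = (Fintype.card R - k : ℕ) * c := by
  obtain ⟨σ, hσ, -, hσm⟩ := exists_minAsg_eq (Q := fun _ => True)
    (hk'.imp fun π hπ => ⟨hπ, trivial⟩) x
  have h1 : ∀ a : R, {x | AvoidsRow a k x}.indicator (fun _ => c) x =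
      if ¬ UsesRow σ a then c else 0 := by
    intro a
    simp only [Set.indicator_apply, Set.mem_ofPred_eq, hx.avoidsRow_iff (hk a) hσ hσm]
  rw [Finset.sum_congr rfl fun a _ => h1 a, ← Finset.sum_filter, Finset.sum_const, nsmul_eq_mul]
  congr 2
  have h2 := Finset.card_filter_add_card_filter_not (s := (Finset.univ : Finset R)) (UsesRow σ)
  rw [card_usesRow hσ, Finset.card_univ] at h2
  omega

theorem IsGeneric.sum_indicator_new_site (hx : IsGeneric x)
    (hk : ∀ (a : R) (j : C), ∃ π : Finset (R × C),
      IsAssignment k π ∧ ¬ UsesRow π a ∧ ¬ UsesCol π j)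
    (hk' : ∃ π : Finset (R × C), IsAssignment (k + 1) π) :
    ∑ p : R × C, ({x | AvoidsRow p.1 k x} ∩
      {x | minAsg (fun π => (p.1, p.2) ∈ π) (k + 1) x = minAll (k + 1) x}).indicator 1 x =
        (1 : ℝ≥0∞) := by
  classical
  have hk0 : ∃ π : Finset (R × C), IsAssignment k π := by
    obtain ⟨π, hπ⟩ := hk'
    obtain ⟨ρ, -, hρ⟩ := hπ.exists_subset k.le_succ
    exact ⟨ρ, hρ⟩
  obtain ⟨σ, hσ, -, hσm⟩ := exists_minAsg_eq (Q := fun _ => True)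
    (hk0.imp fun π hπ => ⟨hπ, trivial⟩) x
  obtain ⟨τ, hτ, -, hτm⟩ := exists_minAsg_eq (Q := fun _ => True)
    (hk'.imp fun π hπ => ⟨hπ, trivial⟩) x
  have h1 : ∀ p : R × C, ({x | AvoidsRow p.1 k x} ∩
      {x | minAsg (fun π => (p.1, p.2) ∈ π) (k + 1) x = minAll (k + 1) x}).indicator 1 x =
        if p ∈ τ.filter (fun p => ¬ UsesRow σ p.1) then (1 : ℝ≥0∞) else 0 := by
    intro p
    have h2 := hx.avoidsRow_iff ((hk p.1 p.2).imp fun π hπ => ⟨hπ.1, hπ.2.1⟩) hσ hσm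
    have h3 : ∃ π : Finset (R × C), IsAssignment (k + 1) π ∧ (p.1, p.2) ∈ π := by
      obtain ⟨π, hπ, hπa, hπj⟩ := hk p.1 p.2
      exact ⟨_, hπ.insert hπa hπj, Finset.mem_insert_self _ _⟩
    simp only [Set.indicator_apply, Set.mem_inter_iff, Set.mem_ofPred_eq, Pi.one_apply, h2,
      hx.minAsg_mem_eq_iff h3 hτ hτm, Finset.mem_filter]
    exact if_congr and_comm rfl rfl
  rw [Finset.sum_congr rfl fun p _ => h1 p, ← Finset.sum_filter, Finset.sum_const, nsmul_eq_mul,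
    mul_one, Finset.filter_mem_eq_inter, Finset.univ_inter,
    card_filter_new_row hσ hτ fun i => hx.usesRow_mono hσ hσm hτ hτm]
  exact Nat.cast_one

/-- The single-site identity summed over all sites: the gains get the number of unused rows as a
factor, and the probabilities add up to `1` because exactly one site enters in a new row. -/
theorem lintegral_sum_gain (hk : ∀ (a : R) (j : C), ∃ π : Finset (R × C),
      IsAssignment k π ∧ ¬ UsesRow π a ∧ ¬ UsesCol π j)
    (hk' : ∃ π : Finset (R × C), IsAssignment (k + 1) π) :
    (Fintype.card R - k : ℕ) * ∫⁻ x, ∑ j : C, ENNReal.ofReal (colGain j k x - prevGain j k x)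
      ∂(expPi R C) = 1 := by
  have hmf : ∀ p : R × C, Measurable ({x | AvoidsRow p.1 k x}.indicator
      fun x => ENNReal.ofReal (colGain p.2 k x - prevGain p.2 k x)) := fun p =>
    ((measurable_colGain p.2 k).sub (measurable_prevGain p.2 k)).ennreal_ofReal.indicator
      (measurableSet_avoidsRow p.1 k)
  have hmg : ∀ p : R × C, Measurable (({x | AvoidsRow p.1 k x} ∩
      {x | minAsg (fun π => (p.1, p.2) ∈ π) (k + 1) x = minAll (k + 1) x}).indicator
        (1 : (R × C → ℝ) → ℝ≥0∞)) := fun p =>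
    measurable_one.indicator
      ((measurableSet_avoidsRow p.1 k).inter (measurableSet_minAsg_mem p.1 p.2 (k + 1)))
  have h1 : ∫⁻ x, ∑ p : R × C, {x | AvoidsRow p.1 k x}.indicator
      (fun x => ENNReal.ofReal (colGain p.2 k x - prevGain p.2 k x)) x ∂(expPi R C) = 1 := by
    rw [lintegral_finsetSum _ fun p _ => hmf p,
      Finset.sum_congr rfl fun p _ => lintegral_gain_eq_measure p.1 p.2 k (hk p.1 p.2),
      ← lintegral_finsetSum _ fun p _ => hmg p]
    have h2 : ∀ᵐ x ∂(expPi R C), ∑ p : R × C, ({x | AvoidsRow p.1 k x} ∩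
      {x | minAsg (fun π => (p.1, p.2) ∈ π) (k + 1) x = minAll (k + 1) x}).indicator 1 x =
        (1 : ℝ≥0∞) := by
      filter_upwards [ae_isGeneric] with x hx
      exact hx.sum_indicator_new_site hk hk'
    rw [lintegral_congr_ae h2]
    simp
  rw [← h1, ← lintegral_const_mul]
  · refine lintegral_congr_ae ?_
    filter_upwards [ae_isGeneric] with x hx
    rw [Fintype.sum_prod_type_right, Finset.mul_sum]
    refine Finset.sum_congr rfl fun j _ => ?_
    have hk0 : ∃ π : Finset (R × C), IsAssignment k π := by
      obtain ⟨π, hπ⟩ := hk'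
      obtain ⟨ρ, -, hρ⟩ := hπ.exists_subset k.le_succ
      exact ⟨ρ, hρ⟩
    rw [← hx.sum_indicator_avoidsRow (fun a => (hk a j).imp fun π hπ => ⟨hπ.1, hπ.2.1⟩) hk0]
    exact Finset.sum_congr rfl fun a _ => by simp only [Set.indicator]
  · exact Finset.measurable_fun_sum _ fun j _ =>
      ((measurable_colGain j k).sub (measurable_prevGain j k)).ennreal_ofReal

theorem abs_minAsg_le (Q : Finset (R × C) → Prop) (k : ℕ) (x : R × C → ℝ) :
    |minAsg Q k x| ≤ ∑ p, |x p| := by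
  by_cases h : ∃ π : Finset (R × C), IsAssignment k π ∧ Q π
  · obtain ⟨π, -, -, h3⟩ := exists_minAsg_eq h x
    rw [← h3]
    exact (Finset.abs_sum_le_sum_abs _ _).trans
      (Finset.sum_le_univ_sum_of_nonneg fun p => abs_nonneg _)
  · have he : {c : ℝ | ∃ π : Finset (R × C), IsAssignment k π ∧ Q π ∧ c = ∑ p ∈ π, x p} = ∅ := by
      rw [Set.eq_empty_iff_forall_notMem]
      rintro c ⟨π, h1, h2, -⟩
      exact h ⟨π, h1, h2⟩
    rw [minAsg, he, Real.sInf_empty, abs_zero]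
    exact Finset.sum_nonneg fun p _ => abs_nonneg _

theorem integrable_minAsg (Q : Finset (R × C) → Prop) (k : ℕ) :
    Integrable (minAsg Q k) (expPi R C) := by
  have h : Integrable (fun x : R × C → ℝ => ∑ p, |x p|) (expPi R C) :=
    integrable_finsetSum _ fun p _ =>
      (integrable_comp_eval (μ := fun _ : R × C => expMeasure 1) (i := p)
        integrable_id_expMeasure).abs
  refine h.mono' (measurable_minAsg Q k).aestronglyMeasurable (Filter.Eventually.of_forall ?_)
  exact fun x => abs_minAsg_le Q k x

theorem integrable_colGain (j : C) (k : ℕ) : Integrable (colGain j k) (expPi R C) :=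
  (integrable_minAsg _ _).sub (integrable_minAsg _ _)

theorem integrable_prevGain (j : C) (k : ℕ) : Integrable (prevGain j k) (expPi R C) := by
  cases k with
  | zero => exact integrable_zero _ _ _
  | succ k => exact integrable_colGain j k

theorem sum_integral_gain (hk : ∀ (a : R) (j : C), ∃ π : Finset (R × C),
      IsAssignment k π ∧ ¬ UsesRow π a ∧ ¬ UsesCol π j)
    (hk' : ∃ π : Finset (R × C), IsAssignment (k + 1) π) :
    (Fintype.card R - k : ℕ) * (∑ j : C, ∫ x, colGain j k x ∂(expPi R C) -
      ∑ j : C, ∫ x, prevGain j k x ∂(expPi R C)) = 1 := by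
  have hR : Nonempty R := by
    obtain ⟨π, hπ⟩ := hk'
    obtain ⟨p, -⟩ := Finset.card_pos.1 (by rw [hπ.1]; exact k.succ_pos)
    exact ⟨p.1⟩
  have hnn : ∀ j : C, ∀ᵐ x ∂(expPi R C), 0 ≤ colGain j k x - prevGain j k x := by
    intro j
    filter_upwards [ae_isGeneric] with x hx
    exact sub_nonneg.2 (prevGain_le_colGain hx.1
      ((hk hR.some j).imp fun π hπ => ⟨hπ.1, hπ.2.2⟩) hk')
  have hint : ∀ j : C, Integrable (fun x => colGain j k x - prevGain j k x) (expPi R C) :=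
    fun j => (integrable_colGain j k).sub (integrable_prevGain j k)
  have h1 : ∑ j : C, ∫ x, colGain j k x ∂(expPi R C) - ∑ j : C, ∫ x, prevGain j k x ∂(expPi R C) =
      (∫⁻ x, ∑ j : C, ENNReal.ofReal (colGain j k x - prevGain j k x) ∂(expPi R C)).toReal := by
    have hm : ∀ j : C, Measurable fun x : R × C → ℝ =>
        ENNReal.ofReal (colGain j k x - prevGain j k x) := fun j =>
      ((measurable_colGain j k).sub (measurable_prevGain j k)).ennreal_ofReal
    rw [lintegral_finsetSum _ fun j _ => hm j,
      ENNReal.toReal_sum fun j _ => (hint j).lintegral_lt_top.ne, ← Finset.sum_sub_distrib]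
    refine Finset.sum_congr rfl fun j _ => ?_
    rw [← integral_sub (integrable_colGain j k) (integrable_prevGain j k),
      integral_eq_lintegral_of_nonneg_ae (hnn j) (hint j).aestronglyMeasurable]
  rw [h1, ← ENNReal.toReal_natCast, ← ENNReal.toReal_mul, lintegral_sum_gain hk hk',
    ENNReal.toReal_one]

end Generic

/-! ### The Coppersmith–Sorkin sum and its square case -/

section Formula

/-- The right-hand side of the Coppersmith–Sorkin formula. -/
def coppersmithSorkin (k m n : ℕ) : ℝ :=
  ∑ p ∈ (Finset.range k ×ˢ Finset.range k).filter (fun p : ℕ × ℕ => p.1 + p.2 < k),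
    1 / (((m : ℝ) - (p.1 : ℝ)) * ((n : ℝ) - (p.2 : ℝ)))

theorem coppersmithSorkin_eq (k m n : ℕ) : coppersmithSorkin k m n =
    ∑ j ∈ Finset.range k, ∑ i ∈ Finset.range (k - j), 1 / (((m : ℝ) - i) * ((n : ℝ) - j)) := by
  rw [coppersmithSorkin, Finset.sum_filter, Finset.sum_product_right]
  refine Finset.sum_congr rfl fun j _ => ?_
  rw [← Finset.sum_filter]
  refine Finset.sum_congr ?_ fun _ _ => rfl
  ext i
  simp only [Finset.mem_filter, Finset.mem_range]
  omega

/-- The terms with `j = 0` split off; shifting `j` in the others mirrors the deletion of a column.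
-/
theorem coppersmithSorkin_succ (k m n : ℕ) : coppersmithSorkin (k + 1) m (n + 1) =
    coppersmithSorkin k m n + (∑ i ∈ Finset.range (k + 1), 1 / ((m : ℝ) - i)) / (n + 1) := by
  rw [coppersmithSorkin_eq, coppersmithSorkin_eq, Finset.sum_range_succ', Finset.sum_div]
  congr 1
  · refine Finset.sum_congr rfl fun j _ => ?_
    rw [Nat.add_sub_add_right]
    refine Finset.sum_congr rfl fun i _ => ?_
    push_cast
    rw [add_sub_add_right_eq_sub]
  · refine Finset.sum_congr rfl fun i _ => ?_
    push_cast
    rw [sub_zero, div_div]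

theorem sum_one_div_sub (n c : ℕ) (hc : c ≤ n) :
    ∑ i ∈ Finset.range c, 1 / ((n : ℝ) - i) =
      ∑ i ∈ Finset.range n, 1 / ((i : ℝ) + 1) - ∑ i ∈ Finset.range (n - c), 1 / ((i : ℝ) + 1) := by
  induction c with
  | zero => simp
  | succ c ih =>
    rw [Finset.sum_range_succ, ih (by omega), show n - c = n - (c + 1) + 1 by omega,
      Finset.sum_range_succ _ (n - (c + 1)), Nat.cast_sub hc]
    push_cast
    ring

theorem coppersmithSorkin_self (n : ℕ) :
    coppersmithSorkin n n n = (∑ i ∈ Finset.range n, 1 / ((i : ℝ) + 1)) ^ 2 -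
      ∑ b ∈ Finset.range n, 1 / ((b : ℝ) + 1) *
        ∑ i ∈ Finset.range (n - 1 - b), 1 / ((i : ℝ) + 1) := by
  rw [coppersmithSorkin_eq, ← Finset.sum_range_reflect, sq, Finset.sum_mul,
    ← Finset.sum_sub_distrib]
  refine Finset.sum_congr rfl fun b hb => ?_
  have hb := Finset.mem_range.1 hb
  rw [show n - 1 - b = n - (b + 1) by omega, show n - (n - (b + 1)) = b + 1 by omega,
    ← mul_sub, ← sum_one_div_sub n (b + 1) hb, Finset.mul_sum]
  refine Finset.sum_congr rfl fun i _ => ?_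
  rw [Nat.cast_sub hb, ← one_div_mul_one_div]
  push_cast
  ring

theorem sum_convolution_succ (n : ℕ) :
    ∑ b ∈ Finset.range (n + 1), 1 / ((b : ℝ) + 1) *
        ∑ i ∈ Finset.range (n - b), 1 / ((i : ℝ) + 1) =
      ∑ b ∈ Finset.range n, 1 / ((b : ℝ) + 1) *
        ∑ i ∈ Finset.range (n - 1 - b), 1 / ((i : ℝ) + 1) +
      2 / ((n : ℝ) + 1) * ∑ i ∈ Finset.range n, 1 / ((i : ℝ) + 1) := by
  have h1 : ∀ b ∈ Finset.range n, 1 / ((b : ℝ) + 1) *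
        ∑ i ∈ Finset.range (n - b), 1 / ((i : ℝ) + 1) =
      1 / ((b : ℝ) + 1) * ∑ i ∈ Finset.range (n - 1 - b), 1 / ((i : ℝ) + 1) +
        (1 / ((n : ℝ) + 1) * (1 / ((b : ℝ) + 1)) +
          1 / ((n : ℝ) + 1) * (1 / (((n - 1 - b : ℕ) : ℝ) + 1))) := by
    intro b hb
    have hb := Finset.mem_range.1 hb
    rw [show n - b = n - 1 - b + 1 by omega, Finset.sum_range_succ, mul_add]
    congr 1
    -- Partial fractions of `1 / ((b + 1) * (n - b))`, whose factors add up to `n + 1`.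
    have h2 : (n : ℝ) = ((n - 1 - b : ℕ) : ℝ) + 1 + b := by
      norm_cast
      omega
    rw [h2]
    field_simp
    ring
  rw [Finset.sum_range_succ, Finset.sum_congr rfl h1, Finset.sum_add_distrib,
    Finset.sum_add_distrib, ← Finset.mul_sum, ← Finset.mul_sum,
    Finset.sum_range_reflect (fun i : ℕ => 1 / ((i : ℝ) + 1))]
  simp only [Nat.sub_self, Finset.range_zero, Finset.sum_empty, mul_zero, add_zero]
  ring

/-- From `n` to `n + 1`, the squared harmonic number `H n ^ 2` grows by `2 * H n / (n + 1) + 1 / (n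
+ 1) ^ 2`, and the convolution cancels the first term. -/
theorem coppersmithSorkin_self_eq (n : ℕ) :
    coppersmithSorkin n n n = ∑ i ∈ Finset.Icc 1 n, 1 / (i : ℝ) ^ 2 := by
  induction n with
  | zero => simp [coppersmithSorkin]
  | succ n ih =>
    rw [Finset.sum_Icc_succ_top (by omega), ← ih, coppersmithSorkin_self, coppersmithSorkin_self,
      Nat.add_sub_cancel, sum_convolution_succ, Finset.sum_range_succ]
    push_cast
    have : (n : ℝ) + 1 ≠ 0 := by positivity
    field_simp
    ring

end Formula

/-! ### Back to random matrices -/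

section Matrix

theorem minCost_eq_minAll {R C : Type*} (k : ℕ) (A : Matrix R C ℝ) :
    minCost k A = minAll k fun p => A p.1 p.2 := by
  simp [minCost, minAsg, cost]

theorem exists_avoiding {m n k : ℕ} (hk : k ≤ min m n) (a : Fin (m + 1)) (j : Fin (n + 1)) :
    ∃ π : Finset (Fin (m + 1) × Fin (n + 1)),
      IsAssignment k π ∧ ¬ UsesRow π a ∧ ¬ UsesCol π j := by
  obtain ⟨π, hπ⟩ := exists_isAssignment hk
  refine ⟨π.map (a.succAboveEmb.prodMap j.succAboveEmb), ⟨?_, ?_⟩, ?_, ?_⟩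
  · rw [Finset.card_map, hπ.1]
  · intro p hp q hq hpq
    obtain ⟨p, hp', rfl⟩ := Finset.mem_map.1 hp
    obtain ⟨q, hq', rfl⟩ := Finset.mem_map.1 hq
    have h := hπ.2 p hp' q hq' fun h => hpq (by rw [h])
    exact ⟨fun e => h.1 (Fin.succAbove_right_injective e),
      fun e => h.2 (Fin.succAbove_right_injective e)⟩
  · rintro ⟨p, hp, hpa⟩
    obtain ⟨p, hp, rfl⟩ := Finset.mem_map.1 hp
    exact Fin.succAbove_ne a p.1 hpa
  · rintro ⟨p, hp, hpj⟩
    obtain ⟨p, hp, rfl⟩ := Finset.mem_map.1 hp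
    exact Fin.succAbove_ne j p.2 hpj

theorem minCost_submatrix_succAbove {m n : ℕ} (k : ℕ) (A : Matrix (Fin m) (Fin (n + 1)) ℝ)
    (j : Fin (n + 1)) :
    minCost k (A.submatrix id j.succAbove) = minCol j k fun p => A p.1 p.2 := by
  unfold minCost minCol minAsg cost
  congr 1
  ext c
  constructor
  · rintro ⟨π, hπ, rfl⟩
    refine ⟨π.map ((Function.Embedding.refl _).prodMap j.succAboveEmb), ⟨?_, ?_⟩,
      ?_, ?_⟩
    · rw [Finset.card_map, hπ.1]
    · intro p hp q hq hpq
      obtain ⟨p, hp', rfl⟩ := Finset.mem_map.1 hp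
      obtain ⟨q, hq', rfl⟩ := Finset.mem_map.1 hq
      have h := hπ.2 p hp' q hq' fun h => hpq (by rw [h])
      exact ⟨fun e => h.1 e, fun e => h.2 (Fin.succAbove_right_injective e)⟩
    · rintro ⟨p, hp, hpj⟩
      obtain ⟨p, hp, rfl⟩ := Finset.mem_map.1 hp
      exact Fin.succAbove_ne j p.2 hpj
    · rw [Finset.sum_map]
      rfl
  · rintro ⟨π, hπ, hπj, rfl⟩
    let e : Fin m × Fin n ↪ Fin m × Fin (n + 1) :=
      (Function.Embedding.refl _).prodMap j.succAboveEmb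
    have he : (π.preimage e e.injective.injOn).map e = π := by
      ext ⟨i, l⟩
      simp only [Finset.mem_map, Finset.mem_preimage]
      constructor
      · rintro ⟨p, hp, h⟩
        exact h ▸ hp
      · intro hp
        obtain ⟨l', hl'⟩ := Fin.exists_succAbove_eq (x := l) (y := j) fun h => hπj ⟨_, hp, h⟩
        have h : e (i, l') = (i, l) := Prod.ext rfl hl'
        exact ⟨(i, l'), h ▸ hp, h⟩
    refine ⟨π.preimage e e.injective.injOn, ⟨?_, ?_⟩, ?_⟩
    · rw [← hπ.1, ← he, Finset.card_map, he]
    · intro p hp q hq hpq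
      have h := hπ.2 (e p) (Finset.mem_preimage.1 hp) (e q) (Finset.mem_preimage.1 hq)
        (e.injective.ne hpq)
      exact ⟨fun h' => h.1 h', fun h' => h.2 (congrArg j.succAbove h')⟩
    · conv_lhs => rw [← he, Finset.sum_map]
      rfl

variable {Ω : Type*} [MeasurableSpace Ω] {P : Measure Ω}

theorem IsRateOneMatrix.submatrix_succAbove {m n : ℕ} {M : Ω → Matrix (Fin m) (Fin (n + 1)) ℝ}
    (hM : IsRateOneMatrix P M) (j : Fin (n + 1)) :
    IsRateOneMatrix P fun ω => (M ω).submatrix id j.succAbove := by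
  refine ⟨fun i l => hM.hasLaw i (j.succAbove l), ?_⟩
  have hinj : Function.Injective
      fun p : Fin m × Fin n => ((p.1, j.succAbove p.2) : Fin m × Fin (n + 1)) := by
    rintro ⟨i, l⟩ ⟨i', l'⟩ h
    simp only [Prod.mk.injEq] at h
    exact Prod.ext h.1 (Fin.succAbove_right_injective h.2)
  exact hM.indep.precomp hinj

variable [IsProbabilityMeasure P] {m n : ℕ}

theorem IsRateOneMatrix.hasLaw_expPi {M : Ω → Matrix (Fin m) (Fin n) ℝ}
    (hM : IsRateOneMatrix P M) :
    HasLaw (fun ω (p : Fin m × Fin n) => M ω p.1 p.2) (expPi (Fin m) (Fin n)) P := by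
  have hae : ∀ p : Fin m × Fin n, AEMeasurable (fun ω => M ω p.1 p.2) P :=
    fun p => (hM.hasLaw p.1 p.2).aemeasurable
  refine ⟨aemeasurable_pi_lambda _ hae, ?_⟩
  rw [(iIndepFun_iff_map_fun_eq_pi_map hae).1 hM.indep]
  congr 1
  funext p
  exact (hM.hasLaw p.1 p.2).map_eq

theorem IsRateOneMatrix.integrable_minAsg {M : Ω → Matrix (Fin m) (Fin n) ℝ}
    (hM : IsRateOneMatrix P M) (Q : Finset (Fin m × Fin n) → Prop) (k : ℕ) :
    Integrable (fun ω => minAsg Q k fun p => M ω p.1 p.2) P := by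
  have h := RandomAssignment.integrable_minAsg (R := Fin m) (C := Fin n) Q k
  rw [← hM.hasLaw_expPi.map_eq] at h
  exact h.comp_aemeasurable hM.hasLaw_expPi.aemeasurable

theorem IsRateOneMatrix.integral_minAsg {M : Ω → Matrix (Fin m) (Fin n) ℝ}
    (hM : IsRateOneMatrix P M) (Q : Finset (Fin m × Fin n) → Prop) (k : ℕ) :
    ∫ ω, minAsg Q k (fun p => M ω p.1 p.2) ∂P = ∫ x, minAsg Q k x ∂(expPi (Fin m) (Fin n)) := by
  rw [← hM.hasLaw_expPi.map_eq, integral_map hM.hasLaw_expPi.aemeasurable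
    (measurable_minAsg Q k).aestronglyMeasurable]

theorem IsRateOneMatrix.integrable_minCost {M : Ω → Matrix (Fin m) (Fin n) ℝ}
    (hM : IsRateOneMatrix P M) (k : ℕ) : Integrable (fun ω => minCost k (M ω)) P := by
  simpa only [minCost_eq_minAll] using hM.integrable_minAsg (fun _ => True) k

/-- Telescoping: `prevGain j (k + 1)` is `colGain j k` by definition, and `prevGain j 0` is zero. -/
theorem sum_integral_colGain {k : ℕ} (hk : k ≤ min m n) :
    ∑ j, ∫ x, colGain j k x ∂(expPi (Fin (m + 1)) (Fin (n + 1))) =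
      ∑ i ∈ Finset.range (k + 1), 1 / (((m + 1 : ℕ) : ℝ) - i) := by
  have hkm : k ≤ m := hk.trans (min_le_left _ _)
  have h1 := sum_integral_gain (k := k) (fun a j => exists_avoiding hk a j)
    (exists_isAssignment (m := m + 1) (n := n + 1) (by omega))
  have h2 : (((m + 1 : ℕ) : ℝ) - k) ≠ 0 := by
    rw [sub_ne_zero]
    norm_cast
    omega
  rw [Fintype.card_fin, Nat.cast_sub (by omega), mul_comm, ← eq_div_iff h2, sub_eq_iff_eq_add] at h1
  rw [Finset.sum_range_succ, h1, add_comm]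
  congr 1
  cases k with
  | zero => simp [prevGain]
  | succ k => exact sum_integral_colGain (by omega)

theorem IsRateOneMatrix.integral_minCost {k : ℕ} (hk : k ≤ min m n)
    {M : Ω → Matrix (Fin m) (Fin n) ℝ} (hM : IsRateOneMatrix P M) :
    ∫ ω, minCost k (M ω) ∂P = coppersmithSorkin k m n := by
  induction k generalizing m n with
  | zero =>
    have h : ∀ A : Matrix (Fin m) (Fin n) ℝ, minCost 0 A = 0 := by
      intro A
      obtain ⟨π, hπ, h⟩ := (isLeast_minCost (Nat.zero_le _) A).1
      rw [h, Finset.card_eq_zero.1 hπ.1]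
      exact Finset.sum_empty
    simp [h, coppersmithSorkin]
  | succ k ih =>
    obtain ⟨m, rfl⟩ : ∃ m', m = m' + 1 := ⟨m - 1, by omega⟩
    obtain ⟨n, rfl⟩ : ∃ n', n = n' + 1 := ⟨n - 1, by omega⟩
    -- The expected gain does not depend on `j`, so the sum over columns is `n + 1` times one
    -- difference of expectations.
    have h1 : ∀ j, ∫ x, colGain j k x ∂(expPi (Fin (m + 1)) (Fin (n + 1))) =
        ∫ ω, minCost (k + 1) (M ω) ∂P - coppersmithSorkin k (m + 1) n := by
      intro j
      rw [← ih (by omega) (hM.submatrix_succAbove j)]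
      simp only [minCost_submatrix_succAbove]
      simp only [minCost_eq_minAll, hM.integral_minAsg]
      exact integral_sub (RandomAssignment.integrable_minAsg _ _)
        (RandomAssignment.integrable_minAsg _ _)
    have h2 := sum_integral_colGain (m := m) (n := n) (k := k) (by omega)
    rw [Finset.sum_congr rfl fun j _ => h1 j, Finset.sum_const, Finset.card_univ,
      Fintype.card_fin, nsmul_eq_mul] at h2
    have h3 : ((n + 1 : ℕ) : ℝ) ≠ 0 := by positivity
    rw [coppersmithSorkin_succ, ← h2]
    push_cast at h3 ⊢
    field_simp
    ring

end Matrix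

end RandomAssignment

end

theorem mainTheorem5 {Ω : Type*} [MeasurableSpace Ω] (P : Measure Ω) [IsProbabilityMeasure P] :
    (∀ (m n k : ℕ), k ≤ min m n →
      ∀ M : Ω → Matrix (Fin m) (Fin n) ℝ, RandomAssignment.IsRateOneMatrix P M →
        Integrable (fun ω => RandomAssignment.minCost k (M ω)) P ∧
        ∫ ω, RandomAssignment.minCost k (M ω) ∂P =
          ∑ p ∈ (Finset.range k ×ˢ Finset.range k).filter (fun p : ℕ × ℕ => p.1 + p.2 < k),
            1 / (((m : ℝ) - (p.1 : ℝ)) * ((n : ℝ) - (p.2 : ℝ)))) ∧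
    (∀ (n : ℕ) (M : Ω → Matrix (Fin n) (Fin n) ℝ), RandomAssignment.IsRateOneMatrix P M →
        Integrable (fun ω => RandomAssignment.minCost n (M ω)) P ∧
        ∫ ω, RandomAssignment.minCost n (M ω) ∂P =
          ∑ i ∈ Finset.Icc 1 n, 1 / (i : ℝ) ^ 2) := by
  refine ⟨fun m n k hk M hM => ⟨hM.integrable_minCost k, hM.integral_minCost hk⟩,
    fun n M hM => ⟨hM.integrable_minCost n, ?_⟩⟩
  rw [hM.integral_minCost (min_self n).ge, RandomAssignment.coppersmithSorkin_self_eq]
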